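/- **Local bifurcation on the hexagonal lattice.** Let $g>0$ and $k_0>0$. Put $\mathbf p_1=\frac{4\pi}{\sqrt3k_0}(0,1)$, $\mathbf p_2=\frac{2\pi}{\sqrt3k_0}(\sqrt3,-1)$, and let $\Omega\subset\mathbb R^2$ be a fundamental domain of the lattice $\mathbb Z\mathbf p_1+\mathbb Z\mathbf p_2$. Let $\mathcal X$ be the space of real functions $v\in H^2_{\mathrm{per}}(\Omega)$ (periodic with respect to $\mathbf p_1,\mathbf p_2$, identified with their continuous representatives) that are invariant under the dihedral group $D_6$ generated by the rotation by $\pi/3$ about the origin and the reflection $(x,y)\mapsto(x,-y)$, and that satisfy $\int_\Omega v\,d\mathbf x=0$, with the norm $\|v\|_{\mathcal X}^2=\int_\Omega \left(v^2+|\nabla v|^2+|D^2v|^2\right)d\mathbf x$, where $|D^2 v|$ is the Frobenius norm of the Hessian. Let $\mathcal U=\{v\in\mathcal X: v>-1\}$ and, for $(v,M)\in\mathcal U\times\mathbb R$, $$F(v,M)=\Delta v-gv+M\left(\frac1{2+v}+\log\frac{1+v}{2+v}\right)-MK(v),$$ where $K(v)$ is the mean value of $\frac1{2+v}+\log\frac{1+v}{2+v}$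 over $\Omega$. Let $M^*(k_0)=4g+4k_0^2$, let $$\psi_0(x,y)=2\cos(k_0x)+2\cos\left(k_0\left(-\tfrac12x+\tfrac{\sqrt3}2y\right)\right)+2\cos\left(k_0\left(\tfrac12x+\tfrac{\sqrt3}2y\right)\right),$$ and $\hat\psi_0=\psi_0/\|\psi_0\|_{\mathcal X}$. Then $F(0,M)=0$ for all $M\in\mathbb R$, and a transcritical bifurcation from this trivial branch occurs at $(0,M^*(k_0))$: there are $\varepsilon>0$ and a continuous curve $s\mapsto(v(s),M(s))$ from $(-\varepsilon,\varepsilon)$ to $\mathcal U\times\mathbb R$ with $(v(0),M(0))=(0,M^*(k_0))$ and $F(v(s),M(s))=0$ for all $s\in(-\varepsilon,\varepsilon)$, such that, as $s\to0$, $$v(s)=s\hat\psi_0+\mathcal O(s^2)\ \text{ in }\mathcal X,\qquad M(s)=M^*(k_0)+\frac{2(g+k_0^2)}{3^{1/4}\pi\sqrt{k_0^2+1+k_0^{-2}}}\,s+\mathcal O(s^2).$$ The coefficient of $s$ in $M(s)$ is positive, $v(s)\ne0$ for $s\neq0$, and $M(s)<M^*(k_0)$ for $s<0$, $M(s)>M^*(k_0)$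 for $s>0$. -/

import Mathlib

open MeasureTheory Filter Topology Asymptotics
open scoped ContDiff

noncomputable section

namespace ThinFilm

/-- The plane `ℝ²` with its Euclidean structure. -/
abbrev Plane : Type := EuclideanSpace ℝ (Fin 2)

/-! ### Hexagonal periodicity and symmetry -/

/-- The period vectors `p₁ = 4π/(√3 k₀) e₂` and `p₂ = 2π/(√3 k₀) (√3, -1)`. -/
def period₁ (k₀ : ℝ) : Plane := !₂[0, 4 * Real.pi / (√3 * k₀)]

def period₂ (k₀ : ℝ) : Plane :=
  !₂[2 * Real.pi / (√3 * k₀) * √3, -(2 * Real.pi / (√3 * k₀))]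

/-- The generators `k₁ = k₀ e₁` and `k₂ = k₀/2 (-1, √3)` of the hexagonal Fourier lattice. -/
def waveVector₁ (k₀ : ℝ) : Plane := !₂[k₀, 0]

def waveVector₂ (k₀ : ℝ) : Plane := !₂[-(k₀ / 2), k₀ / 2 * √3]

/-- Hexagonal periodicity with absolute wave number `k₀`. -/
def HexPeriodic (k₀ : ℝ) (u : Plane → ℝ) : Prop :=
  ∀ x, u (x + period₁ k₀) = u x ∧ u (x + period₂ k₀) = u x

/-- The rotation of the plane by the angle `π/3`. -/
def rot (x : Plane) : Plane :=
  !₂[x 0 / 2 - √3 / 2 * x 1, √3 / 2 * x 0 + x 1 / 2]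

/-- The reflection of the plane in the first coordinate axis. -/
def refl (x : Plane) : Plane := !₂[x 0, -x 1]

/-- Invariance under the dihedral group `D₆`, which is generated by `rot` and `refl`. -/
def HexSymmetric (u : Plane → ℝ) : Prop :=
  ∀ x, u (rot x) = u x ∧ u (refl x) = u x

/-- A fundamental domain of the period lattice: the half-open cell spanned by the two periods.
Integrals of periodic functions over the regular hexagon around the origin, or over any other
fundamental domain, have the same value. -/
def cell (k₀ : ℝ) : Set Plane :=
  {x | ∃ a ∈ Set.Ico (0 : ℝ) 1, ∃ b ∈ Set.Ico (0 : ℝ) 1,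
    x = a • period₁ k₀ + b • period₂ k₀}

/-! ### Weak derivatives and the function spaces -/

/-- `w` is a weak partial derivative of `u` on `ℝ²` in the `i`-th coordinate direction. -/
def HasWeakDeriv (i : Fin 2) (u w : Plane → ℝ) : Prop :=
  LocallyIntegrable u ∧ LocallyIntegrable w ∧
    ∀ φ : Plane → ℝ, ContDiff ℝ ∞ φ → HasCompactSupport φ →
      ∫ x, u x * fderiv ℝ φ x (EuclideanSpace.single i 1) = -∫ x, w x * φ x

open Classical in
/-- The weak partial derivative of `u` (unique up to a null set); `0` if there is none. -/
def weakDeriv (i : Fin 2) (u : Plane → ℝ) : Plane → ℝ :=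
  if h : ∃ w, HasWeakDeriv i u w then h.choose else 0

/-- The weak Laplacian. -/
def weakLaplacian (u : Plane → ℝ) (x : Plane) : ℝ :=
  ∑ i, weakDeriv i (weakDeriv i u) x

/-- Membership in the periodic Sobolev space `H²`: all weak derivatives of order at most two exist
and are square integrable over a period cell. In two dimensions each class in this space has
exactly one continuous representative, and a member is identified with it. -/
structure MemH2per (k₀ : ℝ) (u : Plane → ℝ) : Prop where
  continuous : Continuous u
  periodic : HexPeriodic k₀ u
  memLp : MemLp u 2 (volume.restrict (cell k₀))
  hasWeakDeriv : ∀ i, HasWeakDeriv i u (weakDeriv i u)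
  memLp_weakDeriv : ∀ i, MemLp (weakDeriv i u) 2 (volume.restrict (cell k₀))
  hasWeakDeriv₂ : ∀ i j,
    HasWeakDeriv j (weakDeriv i u) (weakDeriv j (weakDeriv i u))
  memLp_weakDeriv₂ : ∀ i j,
    MemLp (weakDeriv j (weakDeriv i u)) 2 (volume.restrict (cell k₀))

/-- The norm of the periodic Sobolev space: `‖u‖² = ∫ (u² + |∇u|² + |D²u|²)` over a period
cell, where `|D²u|` is the Frobenius norm of the Hessian. -/
def normH2 (k₀ : ℝ) (u : Plane → ℝ) : ℝ :=
  √(∫ x in cell k₀, (u x ^ 2 + ∑ i, weakDeriv i u x ^ 2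
    + ∑ i, ∑ j, weakDeriv j (weakDeriv i u) x ^ 2))

/-- The space `𝒳` of `D₆`-symmetric, mean-zero functions in the periodic Sobolev space `H²`;
its norm is `normH2`. -/
def spaceX (k₀ : ℝ) : Set (Plane → ℝ) :=
  {u | MemH2per k₀ u ∧ HexSymmetric u ∧ ⨍ x in cell k₀, u x = 0}

/-- The subset `𝒰` of those `v ∈ 𝒳` with `v > -1`. -/
def setU (k₀ : ℝ) : Set (Plane → ℝ) :=
  {v | v ∈ spaceX k₀ ∧ ∀ x, -1 < v x}

/-! ### The bifurcation problem -/

/-- The nonlinearity `1/(2+v) + log((1+v)/(2+v))`. -/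
def nonlin (r : ℝ) : ℝ := 1 / (2 + r) + Real.log ((1 + r) / (2 + r))

/-- The mean of the nonlinearity over a period cell. -/
def meanK (k₀ : ℝ) (v : Plane → ℝ) : ℝ := ⨍ x in cell k₀, nonlin (v x)

/-- The bifurcation function `F(v, M) = Δv - g v + M (1/(2+v) + log((1+v)/(2+v))) - M K(v)`. -/
def bifF (g k₀ : ℝ) (v : Plane → ℝ) (M : ℝ) (x : Plane) : ℝ :=
  weakLaplacian v x - g * v x + M * nonlin (v x) - M * meanK k₀ v

/-- `F(v, M) = 0` as an identity in the space of locally square integrable functions. -/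
def IsSolution (g k₀ : ℝ) (v : Plane → ℝ) (M : ℝ) : Prop :=
  bifF g k₀ v M =ᵐ[volume] 0

/-- The critical Marangoni number `M*(k₀) = 4 g + 4 k₀²`. -/
def critM (g k₀ : ℝ) : ℝ := 4 * g + 4 * k₀ ^ 2

/-- The kernel element `ψ₀`, the sum of `exp (i k·x)` over `k = ±k₁, ±k₂, ±(k₁ + k₂)`. -/
def psi (k₀ : ℝ) (x : Plane) : ℝ :=
  2 * Real.cos (inner ℝ (waveVector₁ k₀) x) + 2 * Real.cos (inner ℝ (waveVector₂ k₀) x)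
    + 2 * Real.cos (inner ℝ (waveVector₁ k₀ + waveVector₂ k₀) x)

/-- The normalised kernel element `ψ₀ / ‖ψ₀‖`. -/
def psiHat (k₀ : ℝ) : Plane → ℝ := (normH2 k₀ (psi k₀))⁻¹ • psi k₀

/-- The slope `2 (g + k₀²) / (3^(1/4) π √(k₀² + 1 + k₀⁻²))`. -/
def slope (g k₀ : ℝ) : ℝ :=
  2 * (g + k₀ ^ 2) / ((3 : ℝ) ^ (1 / 4 : ℝ) * Real.pi * √(k₀ ^ 2 + 1 + 1 / k₀ ^ 2))

end ThinFilm

end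

/-! Absolutely summable sequences on the Fourier lattice form a commutative Banach algebra under
convolution. Those fixed by the lattice symmetries form a closed subalgebra `Sym`. They are even, so
their series are pure cosine series and evaluation at a point is multiplicative (`Sym.eval_mul`). If
the unknown is the Laplacian `a ∈ Sym` of the profile, then `v = invLap a` has two weak derivatives
given by uniformly convergent series. For `‖v‖ < 1` the nonlinearity is `nonlin 0 + v * nonlinQuot
v` with a power series `nonlinQuot`. The differential equation thus follows from an equation in
`Sym` (`Sym.isSolution_series`).

Since `nonlin` has derivative 1/4 at 0, the linearisation at `M* = 4(g + k₀²)` multiplies a mode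
with `|k|² = k₀² q` by `-k₀² q - g + M*/4 = k₀² (1 - q)`. Its kernel among symmetric mean-zero
series is spanned by `ψ₀`, the case `q = 1`. Put `v = s u`, `u = r ψ₀ + z`, `M = M* + β`, and divide
the equation by `s`. The unknowns `β` and `z` are packed into one `b ∈ Sym`: the slot of `b` at the
kernel modes, which `Δz` leaves free, holds `β`; the slot at 0 is a slack variable that the equation
forces to vanish; the other slots hold `Δz`. The derivative in `b` at the origin is then diagonal,
with entries 1, `r/4` and `1 - 1/q` (`Sym.hasFDerivAt_reduced_zero_left`). It is invertible for `r ≠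
0`, and the implicit function theorem gives the branch (`Sym.exists_branch`). The entry `r/4` is the
transversality condition.

For the slope, project on `k₁`. One has `u * nonlinQuot (s u) = u/4 - s u²/4 + O(s²)`, and `ψ₀²` has
coefficient 2 at `k₁` because of the hexagonal resonance (`Sym.coeff_chi_mul_chi`). This yields `β =
2 M* r s + O(s²)` (`Sym.coeff_parameter_isBigO`). The choice `r = 1/‖ψ₀‖` and the explicit norm of
`ψ₀` give the stated constant. -/

noncomputable section

namespace ThinFilm

section

/-! ### The convolution algebra of summable sequences on the lattice -/

/-- Absolutely summable real sequences on the lattice `ℤ²`. -/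
abbrev Wiener : Type := lp (fun _ : ℤ × ℤ => ℝ) 1

namespace Wiener

variable {E : Type*} [NormedAddCommGroup E] [NormedSpace ℝ E]

/-- The unit sequence at a lattice point. -/
def delta (k : ℤ × ℤ) : Wiener := lp.single 1 k (1 : ℝ)

theorem delta_apply (k l : ℤ × ℤ) : (delta k : ℤ × ℤ → ℝ) l = if l = k then 1 else 0 := by
  rw [delta, lp.single_apply, Pi.single_apply]

theorem norm_delta (k : ℤ × ℤ) : ‖delta k‖ = 1 := by
  rw [delta, lp.norm_single one_pos]; simp

theorem summable_norm (a : Wiener) : Summable fun k => ‖a k‖ := by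
  simpa using (lp.memℓp a).summable (by simp)

theorem norm_eq (a : Wiener) : ‖a‖ = ∑' k, ‖a k‖ := by
  simpa using lp.norm_eq_tsum_rpow (p := 1) (by simp) a

theorem norm_apply_le (a : Wiener) (k : ℤ × ℤ) : ‖a k‖ ≤ ‖a‖ :=
  lp.norm_apply_le_norm one_ne_zero a k

theorem hasSum_delta (a : Wiener) : HasSum (fun k => a k • delta k) a := by
  have h := lp.hasSum_single (p := 1) (by simp) a
  convert h using 2 with k
  rw [delta, ← lp.single_smul]; simp

/-- Continuous linear maps on `Wiener` are determined by the unit sequences. -/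
theorem clm_ext {f f' : Wiener →L[ℝ] E} (h : ∀ k, f (delta k) = f' (delta k)) : f = f' := by
  ext a
  have h₁ := (hasSum_delta a).mapL f
  have h₂ := (hasSum_delta a).mapL f'
  simp only [map_smul, h] at h₁ h₂
  exact h₁.unique h₂

section lift

variable [CompleteSpace E]

theorem summable_smul {b : ℤ × ℤ → E} {C : ℝ} (hb : ∀ k, ‖b k‖ ≤ C) (a : Wiener) :
    Summable fun k => a k • b k := by
  refine Summable.of_norm_bounded ((summable_norm a).mul_right C) fun k => ?_
  rw [norm_smul]
  exact mul_le_mul_of_nonneg_left (hb k) (norm_nonneg _)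

/-- The continuous linear map that sends the unit sequence at `k` to `b k`. -/
def lift (b : ℤ × ℤ → E) (C : ℝ) (hb : ∀ k, ‖b k‖ ≤ C) : Wiener →L[ℝ] E :=
  LinearMap.mkContinuous
    { toFun := fun a => ∑' k, a k • b k
      map_add' := fun x y => by
        rw [← (summable_smul hb x).tsum_add (summable_smul hb y)]
        exact tsum_congr fun k => by rw [lp.coeFn_add, Pi.add_apply, add_smul]
      map_smul' := fun c x => by
        rw [RingHom.id_apply, ← (summable_smul hb x).tsum_const_smul]
        exact tsum_congr fun k => by rw [lp.coeFn_smul, Pi.smul_apply, smul_assoc] } C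
    fun a => by
      have hs : Summable fun k => ‖a k • b k‖ :=
        Summable.of_nonneg_of_le (fun _ => norm_nonneg _) (fun k => by
          rw [norm_smul]; exact mul_le_mul_of_nonneg_left (hb k) (norm_nonneg _))
          ((summable_norm a).mul_right C)
      calc ‖∑' k, a k • b k‖ ≤ ∑' k, ‖a k • b k‖ := norm_tsum_le_tsum_norm hs
        _ ≤ ∑' k, ‖a k‖ * C := hs.tsum_le_tsum (fun k => by
          rw [norm_smul]; exact mul_le_mul_of_nonneg_left (hb k) (norm_nonneg _))
          ((summable_norm a).mul_right C)
        _ = C * ‖a‖ := by rw [tsum_mul_right, norm_eq, mul_comm]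

theorem lift_apply (b : ℤ × ℤ → E) (C : ℝ) (hb : ∀ k, ‖b k‖ ≤ C) (a : Wiener) :
    lift b C hb a = ∑' k, a k • b k := rfl

@[simp]
theorem lift_delta (b : ℤ × ℤ → E) (C : ℝ) (hb : ∀ k, ‖b k‖ ≤ C) (k : ℤ × ℤ) :
    lift b C hb (delta k) = b k := by
  rw [lift_apply, tsum_eq_single k fun l hl => by simp [delta_apply, hl]]
  simp [delta_apply]

theorem norm_lift_le (b : ℤ × ℤ → E) (C : ℝ) (hC : 0 ≤ C) (hb : ∀ k, ‖b k‖ ≤ C) :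
    ‖lift b C hb‖ ≤ C :=
  LinearMap.mkContinuous_norm_le _ hC _

end lift

/-- Translation of sequences. -/
def shift (k : ℤ × ℤ) : Wiener →L[ℝ] Wiener :=
  lift (fun l => delta (k + l)) 1 fun _ => (norm_delta _).le

theorem norm_shift_le (k : ℤ × ℤ) : ‖shift k‖ ≤ 1 := norm_lift_le _ _ zero_le_one _

/-- Convolution of sequences. -/
def conv : Wiener →L[ℝ] Wiener →L[ℝ] Wiener :=
  lift shift 1 norm_shift_le

@[simp]
theorem conv_delta (k l : ℤ × ℤ) : conv (delta k) (delta l) = delta (k + l) := by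
  rw [conv, lift_delta, shift, lift_delta]

/-- Both sides are continuous and bilinear, so the identity reduces to commutativity of addition of
lattice points. Associativity and the unit law reduce to the group laws of `ℤ × ℤ` in the same way.
-/
theorem conv_comm (a b : Wiener) : conv a b = conv b a := by
  have : conv = conv.flip := clm_ext fun k => clm_ext fun l => by simp [add_comm]
  exact congrArg (fun f => f a b) this

theorem zero_conv (a : Wiener) : conv (delta 0) a = a := by
  have : conv (delta 0) = ContinuousLinearMap.id ℝ Wiener := clm_ext fun k => by simp
  exact congrArg (fun f => f a) this

theorem conv_assoc (a b c : Wiener) : conv (conv a b) c = conv a (conv b c) := by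
  have : (ContinuousLinearMap.compL ℝ Wiener Wiener (Wiener →L[ℝ] Wiener) conv).comp conv =
      ((ContinuousLinearMap.compL ℝ Wiener Wiener Wiener).flip.comp conv).flip.comp conv := by
    refine clm_ext fun k => clm_ext fun l => clm_ext fun m => ?_
    simp [add_assoc]
  exact congrArg (fun f => f a b c) this

theorem norm_conv_le (a b : Wiener) : ‖conv a b‖ ≤ ‖a‖ * ‖b‖ :=
  (conv.le_opNorm₂ a b).trans <| by
    gcongr
    exact mul_le_of_le_one_left (norm_nonneg _) (norm_lift_le _ _ zero_le_one _)

instance : NormedCommRing Wiener :=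
  { (inferInstance : NormedAddCommGroup Wiener) with
    mul := fun a b => conv a b
    one := delta 0
    mul_assoc := conv_assoc
    one_mul := zero_conv
    mul_one := fun a => (conv_comm a _).trans (zero_conv a)
    left_distrib := fun a b c => map_add (conv a) b c
    right_distrib := fun a b c => congrArg (fun f => f c) (map_add conv a b)
    zero_mul := fun a => congrArg (fun f => f a) (map_zero conv)
    mul_zero := fun a => map_zero (conv a)
    mul_comm := conv_comm
    norm_mul_le := norm_conv_le }

theorem one_def : (1 : Wiener) = delta 0 := rfl

instance : NormedAlgebra ℝ Wiener :=
  { Algebra.ofModule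
      (fun r a b => congrArg (fun f => f b) (map_smul conv r a))
      (fun r a b => map_smul (conv a) r b) with
    norm_smul_le := fun r a => norm_smul_le r a }

instance : NormOneClass Wiener := ⟨norm_delta 0⟩

/-- Two continuous linear maps that agree on products of unit sequences agree on all products. -/
theorem mul_ext (f : Wiener →L[ℝ] E) (B : Wiener →L[ℝ] Wiener →L[ℝ] E)
    (h : ∀ k l, f (delta (k + l)) = B (delta k) (delta l)) (a b : Wiener) :
    f (a * b) = B a b := by
  have : (ContinuousLinearMap.compL ℝ Wiener Wiener E f).comp conv = B := by
    refine clm_ext fun k => clm_ext fun l => ?_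
    simp [h]
  exact congrArg (fun g => g a b) this

/-- The coefficient at a lattice point as a continuous linear functional. -/
def coeff (k : ℤ × ℤ) : Wiener →L[ℝ] ℝ := lp.evalCLM ℝ _ _ k

@[simp]
theorem coeff_apply (k : ℤ × ℤ) (a : Wiener) : coeff k a = a k := rfl

/-- The Fourier multiplier with bounded symbol `m`. -/
def multiplier (m : ℤ × ℤ → ℝ) (C : ℝ) (hm : ∀ k, |m k| ≤ C) : Wiener →L[ℝ] Wiener :=
  lift (fun k => m k • delta k) C fun k => by rw [norm_smul, norm_delta, mul_one]; exact hm k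

@[simp]
theorem multiplier_delta (m : ℤ × ℤ → ℝ) (C : ℝ) (hm : ∀ k, |m k| ≤ C) (k : ℤ × ℤ) :
    multiplier m C hm (delta k) = m k • delta k := lift_delta ..

@[simp]
theorem multiplier_apply (m : ℤ × ℤ → ℝ) (C : ℝ) (hm : ∀ k, |m k| ≤ C) (a : Wiener)
    (k : ℤ × ℤ) : multiplier m C hm a k = m k * a k := by
  have : (coeff k).comp (multiplier m C hm) = m k • coeff k := by
    refine clm_ext fun l => ?_
    by_cases h : k = l <;> simp [delta_apply, h]
  exact congrArg (fun f => f a) this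

/-- The linear substitution of the lattice points. -/
def reindex (e : ℤ × ℤ →+ ℤ × ℤ) : Wiener →L[ℝ] Wiener :=
  lift (fun k => delta (e k)) 1 fun _ => (norm_delta _).le

@[simp]
theorem reindex_delta (e : ℤ × ℤ →+ ℤ × ℤ) (k : ℤ × ℤ) :
    reindex e (delta k) = delta (e k) := lift_delta ..

theorem reindex_mul (e : ℤ × ℤ →+ ℤ × ℤ) (a b : Wiener) :
    reindex e (a * b) = reindex e a * reindex e b :=
  mul_ext (reindex e)
    ((ContinuousLinearMap.compL ℝ Wiener Wiener Wiener).flip (reindex e) ∘L conv ∘L reindex e)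
    (fun k l => by simp) a b

theorem reindex_one (e : ℤ × ℤ →+ ℤ × ℤ) : reindex e 1 = 1 := by
  rw [one_def, reindex_delta, map_zero]

/-- Injectivity ensures that no other lattice point is moved to `e k`. -/
theorem reindex_apply (e : ℤ × ℤ →+ ℤ × ℤ) (he : Function.Injective e) (a : Wiener)
    (k : ℤ × ℤ) : reindex e a (e k) = a k := by
  have : (coeff (e k)).comp (reindex e) = coeff k :=
    clm_ext fun l => by simp [delta_apply, he.eq_iff]
  exact congrArg (fun f => f a) this

end Wiener

end

section

/-! ### Trigonometric series over the hexagonal lattice and their weak derivatives -/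

/-- The wave vector `m k₁ + n k₂`. -/
def waveVec (k₀ : ℝ) (k : ℤ × ℤ) : Plane :=
  (k.1 : ℝ) • waveVector₁ k₀ + (k.2 : ℝ) • waveVector₂ k₀

/-- The trigonometric series with coefficients `c` and phase shift `θ`. -/
def trig (k₀ θ : ℝ) (c : ℤ × ℤ → ℝ) (x : Plane) : ℝ :=
  ∑' k, c k * Real.cos (inner ℝ (waveVec k₀ k) x + θ)

variable {k₀ θ : ℝ} {c : ℤ × ℤ → ℝ}

theorem norm_trig_term_le (k₀ θ : ℝ) (c : ℤ × ℤ → ℝ) (k : ℤ × ℤ) (x : Plane) :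
    ‖c k * Real.cos (inner ℝ (waveVec k₀ k) x + θ)‖ ≤ |c k| := by
  rw [norm_mul, Real.norm_eq_abs, Real.norm_eq_abs]
  exact mul_le_of_le_one_right (abs_nonneg _) (Real.abs_cos_le_one _)

theorem summable_trig (hc : Summable fun k => |c k|) (x : Plane) :
    Summable fun k => c k * Real.cos (inner ℝ (waveVec k₀ k) x + θ) :=
  Summable.of_norm_bounded hc fun k => norm_trig_term_le k₀ θ c k x

theorem continuous_trig (hc : Summable fun k => |c k|) : Continuous (trig k₀ θ c) :=
  continuous_tsum (fun k => by fun_prop) hc fun k x => norm_trig_term_le k₀ θ c k x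

theorem abs_trig_le (hc : Summable fun k => |c k|) (x : Plane) :
    |trig k₀ θ c x| ≤ ∑' k, |c k| :=
  tsum_of_norm_bounded hc.hasSum fun k => norm_trig_term_le k₀ θ c k x

/-- Termwise differentiation under a summable bound. Writing `-sin` as a cosine with phase advanced
by `π/2` keeps all derivatives within the family `trig`. -/
theorem hasFDerivAt_trig (hc : Summable fun k => |c k|)
    (hc' : Summable fun k => ‖waveVec k₀ k‖ * |c k|) (x : Plane) :
    HasFDerivAt (trig k₀ θ c)
      (∑' k, (c k * Real.cos (inner ℝ (waveVec k₀ k) x + (θ + Real.pi / 2))) •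
        innerSL ℝ (waveVec k₀ k)) x := by
  refine hasFDerivAt_tsum (f := fun k y => c k * Real.cos (inner ℝ (waveVec k₀ k) y + θ))
    (f' := fun k y => (c k * Real.cos (inner ℝ (waveVec k₀ k) y + (θ + Real.pi / 2))) •
      innerSL ℝ (waveVec k₀ k)) (x₀ := 0) hc' (fun k y => ?_) (fun k y => ?_) (summable_trig hc 0) x
  · have h := (((innerSL ℝ (waveVec k₀ k)).hasFDerivAt (x := y)).add_const θ).cos.const_mul (c k)
    refine h.congr_fderiv ?_
    rw [← add_assoc, Real.cos_add_pi_div_two, smul_smul]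
    rfl
  · rw [norm_smul, innerSL_apply_norm, mul_comm]
    exact mul_le_mul_of_nonneg_left (norm_trig_term_le k₀ _ c k y) (norm_nonneg _)

/-- The coefficients of a partial derivative. -/
def derivCoeff (k₀ : ℝ) (i : Fin 2) (c : ℤ × ℤ → ℝ) (k : ℤ × ℤ) : ℝ := waveVec k₀ k i * c k

theorem abs_derivCoeff_le (k₀ : ℝ) (i : Fin 2) (c : ℤ × ℤ → ℝ) (k : ℤ × ℤ) :
    |derivCoeff k₀ i c k| ≤ ‖waveVec k₀ k‖ * |c k| := by
  rw [derivCoeff, abs_mul]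
  exact mul_le_mul_of_nonneg_right (PiLp.norm_apply_le (waveVec k₀ k) i) (abs_nonneg _)

theorem summable_derivCoeff (hc' : Summable fun k => ‖waveVec k₀ k‖ * |c k|) (i : Fin 2) :
    Summable fun k => |derivCoeff k₀ i c k| :=
  Summable.of_nonneg_of_le (fun _ => abs_nonneg _) (abs_derivCoeff_le k₀ i c) hc'

theorem fderiv_trig_single (hc : Summable fun k => |c k|)
    (hc' : Summable fun k => ‖waveVec k₀ k‖ * |c k|) (i : Fin 2) (x : Plane) :
    fderiv ℝ (trig k₀ θ c) x (EuclideanSpace.single i 1) =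
      trig k₀ (θ + Real.pi / 2) (derivCoeff k₀ i c) x := by
  rw [(hasFDerivAt_trig hc hc' x).fderiv]
  have hs : Summable fun k =>
      (c k * Real.cos (inner ℝ (waveVec k₀ k) x + (θ + Real.pi / 2))) •
        innerSL ℝ (waveVec k₀ k) := by
    refine Summable.of_norm_bounded hc' fun k => ?_
    rw [norm_smul, innerSL_apply_norm, mul_comm]
    exact mul_le_mul_of_nonneg_left (norm_trig_term_le k₀ _ c k x) (norm_nonneg _)
  have h := hs.hasSum.mapL (ContinuousLinearMap.apply ℝ ℝ (EuclideanSpace.single i (1 : ℝ)))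
  rw [ContinuousLinearMap.apply_apply] at h
  rw [← h.tsum_eq, trig]
  refine tsum_congr fun k => ?_
  simp [derivCoeff, EuclideanSpace.inner_single_right]
  ring

/-- The classical derivative is continuous, so integration by parts against a compactly supported
test function applies. -/
theorem hasWeakDeriv_trig (hc : Summable fun k => |c k|)
    (hc' : Summable fun k => ‖waveVec k₀ k‖ * |c k|) (i : Fin 2) :
    HasWeakDeriv i (trig k₀ θ c) (trig k₀ (θ + Real.pi / 2) (derivCoeff k₀ i c)) := by
  have h₁ : Continuous (trig k₀ θ c) := continuous_trig hc
  have h₂ : Continuous fun x => trig k₀ (θ + Real.pi / 2) (derivCoeff k₀ i c) x :=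
    continuous_trig (summable_derivCoeff hc' i)
  refine ⟨h₁.locallyIntegrable, h₂.locallyIntegrable, fun φ hφ hφc => ?_⟩
  have hφ' : Continuous fun x => fderiv ℝ φ x (EuclideanSpace.single i 1) :=
    (hφ.continuous_fderiv (by simp)).clm_apply continuous_const
  have hφ'c : HasCompactSupport fun x => fderiv ℝ φ x (EuclideanSpace.single i 1) :=
    hφc.fderiv_apply ℝ _
  simp_rw [← fderiv_trig_single hc hc' i] at h₂ ⊢
  exact integral_mul_fderiv_eq_neg_fderiv_mul_of_integrable
    ((h₂.mul hφ.continuous).integrable_of_hasCompactSupport hφc.mul_left)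
    ((h₁.mul hφ').integrable_of_hasCompactSupport hφ'c.mul_left)
    ((h₁.mul hφ.continuous).integrable_of_hasCompactSupport hφc.mul_left)
    (fun x _ => (hasFDerivAt_trig hc hc' x).differentiableAt)
    (fun x _ => (hφ.differentiable (by simp)).differentiableAt)

/-! ### Uniqueness of weak derivatives up to null sets. -/

theorem HasWeakDeriv.unique {i : Fin 2} {u w w' : Plane → ℝ} (h : HasWeakDeriv i u w)
    (h' : HasWeakDeriv i u w') : w =ᵐ[volume] w' := by
  refine ae_eq_of_integral_contDiff_smul_eq h.2.1 h'.2.1 fun φ hφ hφc => ?_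
  have := (h.2.2 φ hφ hφc).symm.trans (h'.2.2 φ hφ hφc)
  simpa [mul_comm] using this

/-- Needed for second derivatives: `weakDeriv` is an arbitrary choice that agrees with the explicit
series only almost everywhere, and it is differentiated again. -/
theorem HasWeakDeriv.congr_left {i : Fin 2} {u u' w : Plane → ℝ} (h : HasWeakDeriv i u w)
    (hu : u =ᵐ[volume] u') : HasWeakDeriv i u' w := by
  refine ⟨h.1.congr hu, h.2.1, fun φ hφ hφc => ?_⟩
  rw [← h.2.2 φ hφ hφc]
  refine integral_congr_ae ?_
  filter_upwards [hu] with x hx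
  rw [hx]

theorem HasWeakDeriv.hasWeakDeriv_weakDeriv {i : Fin 2} {u w : Plane → ℝ}
    (h : HasWeakDeriv i u w) : HasWeakDeriv i u (weakDeriv i u) := by
  have he : ∃ w, HasWeakDeriv i u w := ⟨w, h⟩
  rw [weakDeriv, dif_pos he]
  exact he.choose_spec

theorem HasWeakDeriv.weakDeriv_ae_eq {i : Fin 2} {u w : Plane → ℝ}
    (h : HasWeakDeriv i u w) : weakDeriv i u =ᵐ[volume] w :=
  h.hasWeakDeriv_weakDeriv.unique h

/-- Coefficients whose trigonometric series is twice continuously differentiable. -/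
def Decays (k₀ : ℝ) (c : ℤ × ℤ → ℝ) : Prop :=
  Summable fun k => (1 + ‖waveVec k₀ k‖ ^ 2) * |c k|

namespace Decays

theorem summable (h : Decays k₀ c) : Summable fun k => |c k| :=
  Summable.of_nonneg_of_le (fun _ => abs_nonneg _) (fun k => by
    nlinarith [abs_nonneg (c k), mul_nonneg (sq_nonneg ‖waveVec k₀ k‖) (abs_nonneg (c k))]) h

theorem norm_mul_le (k₀ : ℝ) (c : ℤ × ℤ → ℝ) (k : ℤ × ℤ) :
    ‖waveVec k₀ k‖ * |c k| ≤ (1 + ‖waveVec k₀ k‖ ^ 2) * |c k| := by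
  refine mul_le_mul_of_nonneg_right ?_ (abs_nonneg _)
  nlinarith [sq_nonneg (‖waveVec k₀ k‖ - 1)]

theorem summable₁ (h : Decays k₀ c) : Summable fun k => ‖waveVec k₀ k‖ * |c k| :=
  Summable.of_nonneg_of_le (fun _ => by positivity) (norm_mul_le k₀ c) h

theorem norm_mul_deriv_le (k₀ : ℝ) (c : ℤ × ℤ → ℝ) (i : Fin 2) (k : ℤ × ℤ) :
    ‖waveVec k₀ k‖ * |derivCoeff k₀ i c k| ≤ (1 + ‖waveVec k₀ k‖ ^ 2) * |c k| := by
  have := mul_le_mul_of_nonneg_left (abs_derivCoeff_le k₀ i c k) (norm_nonneg (waveVec k₀ k))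
  nlinarith [abs_nonneg (c k)]

theorem summable₂ (h : Decays k₀ c) (i : Fin 2) :
    Summable fun k => ‖waveVec k₀ k‖ * |derivCoeff k₀ i c k| :=
  Summable.of_nonneg_of_le (fun _ => by positivity) (norm_mul_deriv_le k₀ c i) h

theorem weakDeriv_ae_eq (h : Decays k₀ c) (θ : ℝ) (i : Fin 2) :
    weakDeriv i (trig k₀ θ c) =ᵐ[volume] trig k₀ (θ + Real.pi / 2) (derivCoeff k₀ i c) :=
  (hasWeakDeriv_trig h.summable h.summable₁ i).weakDeriv_ae_eq

theorem hasWeakDeriv₂ (h : Decays k₀ c) (θ : ℝ) (i j : Fin 2) :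
    HasWeakDeriv j (weakDeriv i (trig k₀ θ c))
      (trig k₀ (θ + Real.pi / 2 + Real.pi / 2) (derivCoeff k₀ j (derivCoeff k₀ i c))) :=
  (hasWeakDeriv_trig (summable_derivCoeff h.summable₁ i) (h.summable₂ i) j).congr_left
    (h.weakDeriv_ae_eq θ i).symm

theorem weakDeriv₂_ae_eq (h : Decays k₀ c) (θ : ℝ) (i j : Fin 2) :
    weakDeriv j (weakDeriv i (trig k₀ θ c)) =ᵐ[volume]
      trig k₀ (θ + Real.pi / 2 + Real.pi / 2) (derivCoeff k₀ j (derivCoeff k₀ i c)) :=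
  (h.hasWeakDeriv₂ θ i j).weakDeriv_ae_eq

/-- Two phase shifts by `π/2` change the sign of the cosine, and the squared components of the wave
vector add up to its squared norm. -/
theorem weakLaplacian_ae_eq (h : Decays k₀ c) (θ : ℝ) :
    weakLaplacian (trig k₀ θ c) =ᵐ[volume]
      trig k₀ θ (fun k => -(‖waveVec k₀ k‖ ^ 2 * c k)) := by
  filter_upwards [h.weakDeriv₂_ae_eq θ 0 0, h.weakDeriv₂_ae_eq θ 1 1] with x h₀ h₁
  rw [weakLaplacian, Fin.sum_univ_two, h₀, h₁, trig, trig, trig,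
    ← (summable_trig (summable_derivCoeff (h.summable₂ 0) 0) x).tsum_add
      (summable_trig (summable_derivCoeff (h.summable₂ 1) 1) x)]
  refine tsum_congr fun k => ?_
  rw [← add_assoc, ← add_assoc, Real.cos_add_pi_div_two, Real.sin_add_pi_div_two,
    EuclideanSpace.norm_sq_eq, Fin.sum_univ_two]
  simp only [derivCoeff, Real.norm_eq_abs, sq_abs]
  ring

end Decays

end

section

/-! ### Integration over the period cell -/

/-- The area of the period cell. -/
def cellArea (k₀ : ℝ) : ℝ := 8 * Real.pi ^ 2 / (√3 * k₀ ^ 2)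

theorem cellArea_pos {k₀ : ℝ} (hk₀ : 0 < k₀) : 0 < cellArea k₀ := by
  unfold cellArea; positivity

/-- The linear parametrisation of the period cell by the unit square. -/
def cellMap (k₀ : ℝ) : Plane →L[ℝ] Plane :=
  (EuclideanSpace.proj (0 : Fin 2) : Plane →L[ℝ] ℝ).smulRight (period₁ k₀) +
    (EuclideanSpace.proj (1 : Fin 2) : Plane →L[ℝ] ℝ).smulRight (period₂ k₀)

theorem cellMap_apply (k₀ : ℝ) (x : Plane) :
    cellMap k₀ x = x 0 • period₁ k₀ + x 1 • period₂ k₀ := rfl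

theorem abs_det_cellMap {k₀ : ℝ} (hk₀ : 0 < k₀) : |(cellMap k₀).det| = cellArea k₀ := by
  have h : (cellMap k₀).det = -cellArea k₀ := by
    have h3 : √3 ^ 2 = 3 := Real.sq_sqrt (by norm_num)
    have h3' : √3 ≠ 0 := by positivity
    rw [ContinuousLinearMap.det,
      ← LinearMap.det_toMatrix (EuclideanSpace.basisFun (Fin 2) ℝ).toBasis, Matrix.det_fin_two]
    simp only [LinearMap.toMatrix_apply, ContinuousLinearMap.coe_coe, cellMap_apply]
    simp [period₁, period₂, cellArea]
    field_simp
    ring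
  rw [h, abs_neg, abs_of_pos (cellArea_pos hk₀)]

/-- The unit square. -/
def unitSquare : Set Plane := {x | x 0 ∈ Set.Ico (0 : ℝ) 1 ∧ x 1 ∈ Set.Ico (0 : ℝ) 1}

/-- The coordinates of the plane as a measurable equivalence. -/
def coords : Plane ≃ᵐ ℝ × ℝ :=
  (MeasurableEquiv.toLp 2 (Fin 2 → ℝ)).symm.trans MeasurableEquiv.finTwoArrow

theorem measurePreserving_coords : MeasurePreserving coords :=
  (EuclideanSpace.volume_preserving_symm_measurableEquiv_toLp (Fin 2)).trans
    (volume_preserving_finTwoArrow ℝ)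

theorem unitSquare_eq : unitSquare = coords ⁻¹' (Set.Ico 0 1 ×ˢ Set.Ico 0 1) := rfl

theorem measurableSet_unitSquare : MeasurableSet unitSquare :=
  coords.measurable (measurableSet_Ico.prod measurableSet_Ico)

theorem volume_unitSquare : volume unitSquare = 1 := by
  rw [unitSquare_eq, measurePreserving_coords.measure_preimage
    (measurableSet_Ico.prod measurableSet_Ico).nullMeasurableSet, Measure.volume_eq_prod,
    Measure.prod_prod]
  simp

theorem cell_eq (k₀ : ℝ) : cell k₀ = cellMap k₀ '' unitSquare := by
  ext x
  constructor
  · rintro ⟨a, ha, b, hb, rfl⟩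
    exact ⟨!₂[a, b], ⟨by simpa using ha, by simpa using hb⟩, by simp [cellMap_apply]⟩
  · rintro ⟨y, ⟨h₀, h₁⟩, rfl⟩
    exact ⟨y 0, h₀, y 1, h₁, rfl⟩

theorem volume_cell {k₀ : ℝ} (hk₀ : 0 < k₀) :
    volume (cell k₀) = ENNReal.ofReal (cellArea k₀) := by
  rw [cell_eq, Measure.addHaar_image_continuousLinearMap, abs_det_cellMap hk₀, volume_unitSquare,
    mul_one]

theorem volume_real_cell {k₀ : ℝ} (hk₀ : 0 < k₀) : volume.real (cell k₀) = cellArea k₀ := by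
  rw [Measure.real, volume_cell hk₀, ENNReal.toReal_ofReal (cellArea_pos hk₀).le]

theorem isFiniteMeasure_cell {k₀ : ℝ} (hk₀ : 0 < k₀) :
    IsFiniteMeasure (volume.restrict (cell k₀)) :=
  ⟨by rw [Measure.restrict_apply_univ, volume_cell hk₀]; exact ENNReal.ofReal_lt_top⟩

theorem injective_cellMap {k₀ : ℝ} (hk₀ : 0 < k₀) : Function.Injective (cellMap k₀) := by
  have h : IsUnit (LinearMap.det (cellMap k₀ : Plane →ₗ[ℝ] Plane)) := by
    refine isUnit_iff_ne_zero.2 fun h0 => (cellArea_pos hk₀).ne' ?_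
    rw [← abs_det_cellMap hk₀, ContinuousLinearMap.det, h0, abs_zero]
  exact (LinearEquiv.ofIsUnitDet (v := (EuclideanSpace.basisFun (Fin 2) ℝ).toBasis)
    (v' := (EuclideanSpace.basisFun (Fin 2) ℝ).toBasis) (f := (cellMap k₀ : Plane →ₗ[ℝ] Plane))
    (by rwa [LinearMap.det_toMatrix])).injective

theorem integral_cell {k₀ : ℝ} (hk₀ : 0 < k₀) {f : Plane → ℝ} (hf : Continuous f) :
    ∫ x in cell k₀, f x = cellArea k₀ *
      ∫ a in Set.Ico (0 : ℝ) 1, ∫ b in Set.Ico (0 : ℝ) 1, f (a • period₁ k₀ + b • period₂ k₀) := by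
  rw [cell_eq, integral_image_eq_integral_abs_det_fderiv_smul volume measurableSet_unitSquare
    (fun x _ => (cellMap k₀).hasFDerivAt.hasFDerivWithinAt) (injective_cellMap hk₀).injOn]
  simp_rw [abs_det_cellMap hk₀, smul_eq_mul]
  rw [integral_const_mul, unitSquare_eq]
  congr 1
  have h := measurePreserving_coords.setIntegral_preimage_emb coords.measurableEmbedding
    (fun p : ℝ × ℝ => f (p.1 • period₁ k₀ + p.2 • period₂ k₀)) (Set.Ico 0 1 ×ˢ Set.Ico 0 1)
  refine h.trans ?_
  have hc : Continuous fun p : ℝ × ℝ => f (p.1 • period₁ k₀ + p.2 • period₂ k₀) := by fun_prop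
  rw [Measure.volume_eq_prod, setIntegral_prod]
  refine (hc.continuousOn.integrableOn_compact
    (isCompact_Icc.prod isCompact_Icc (s := Set.Icc (0 : ℝ) 1)
      (t := Set.Icc (0 : ℝ) 1))).mono_set ?_
  exact Set.prod_mono Set.Ico_subset_Icc_self Set.Ico_subset_Icc_self

theorem integral_cos_period {j : ℤ} (hj : j ≠ 0) (γ : ℝ) :
    ∫ b in Set.Ico (0 : ℝ) 1, Real.cos (2 * Real.pi * j * b + γ) = 0 := by
  have hj' : 2 * Real.pi * (j : ℝ) ≠ 0 := by simp [hj, Real.pi_ne_zero]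
  rw [integral_Ico_eq_integral_Ioc, ← intervalIntegral.integral_of_le zero_le_one,
    intervalIntegral.integral_comp_mul_add Real.cos hj', integral_cos,
    show 2 * Real.pi * (j : ℝ) * 1 + γ = γ + j * (2 * Real.pi) by ring,
    Real.sin_add_int_mul_two_pi]
  simp

/-- The wave vectors lie in the lattice dual to the periods. Integrality of this product and the
next gives both periodicity and orthogonality. -/
theorem inner_waveVec_period₁ {k₀ : ℝ} (hk₀ : 0 < k₀) (k : ℤ × ℤ) :
    inner ℝ (waveVec k₀ k) (period₁ k₀) = 2 * Real.pi * k.2 := by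
  have h3' : √3 ≠ 0 := by positivity
  simp [waveVec, waveVector₁, waveVector₂, period₁, PiLp.inner_apply, Fin.sum_univ_two]
  field_simp
  ring

theorem inner_waveVec_period₂ {k₀ : ℝ} (hk₀ : 0 < k₀) (k : ℤ × ℤ) :
    inner ℝ (waveVec k₀ k) (period₂ k₀) = 2 * Real.pi * ((k.1 - k.2 : ℤ) : ℝ) := by
  have h3' : √3 ≠ 0 := by positivity
  simp [waveVec, waveVector₁, waveVector₂, period₂, PiLp.inner_apply, Fin.sum_univ_two]
  field_simp
  ring

/-- The quadratic form of the hexagonal lattice. -/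
def quadForm (k : ℤ × ℤ) : ℤ := k.1 ^ 2 - k.1 * k.2 + k.2 ^ 2

theorem norm_waveVec_sq (k₀ : ℝ) (k : ℤ × ℤ) :
    ‖waveVec k₀ k‖ ^ 2 = k₀ ^ 2 * quadForm k := by
  have h3 : √3 ^ 2 = 3 := Real.sq_sqrt (by norm_num)
  rw [EuclideanSpace.norm_sq_eq]
  simp [quadForm, waveVec, waveVector₁, waveVector₂, Fin.sum_univ_two]
  linear_combination (k.2 : ℝ) ^ 2 * k₀ ^ 2 / 4 * h3

theorem integral_cell_cos {k₀ : ℝ} (hk₀ : 0 < k₀) (k : ℤ × ℤ) (θ : ℝ) :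
    ∫ x in cell k₀, Real.cos (inner ℝ (waveVec k₀ k) x + θ) =
      if k = 0 then cellArea k₀ * Real.cos θ else 0 := by
  split_ifs with hk
  · subst hk
    simp [waveVec, volume_real_cell hk₀]
  · rw [integral_cell hk₀ (by fun_prop)]
    simp_rw [inner_add_right, inner_smul_right, inner_waveVec_period₁ hk₀,
      inner_waveVec_period₂ hk₀]
    -- Along the second period the phase makes `k.1 - k.2` full turns. If this is not zero, the
    -- inner integral vanishes; otherwise `k.2 ≠ 0` and the integral along the first period
    -- vanishes.
    by_cases h : k.1 - k.2 = 0
    · have h2 : k.2 ≠ 0 := fun h2 => hk (Prod.ext (by simpa [h2] using h) h2)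
      have := integral_cos_period h2 θ
      simp only [h, Int.cast_zero, mul_zero, add_zero, integral_const, MeasurableSet.univ,
        measureReal_restrict_apply, Set.univ_inter, Real.volume_real_Ico, sub_zero, zero_le_one,
        sup_of_le_left, smul_eq_mul, one_mul, mul_eq_zero]
      right
      refine (integral_congr_ae (ae_of_all _ fun a => ?_)).trans this
      ring_nf
    · have h' : ∀ a : ℝ, ∫ b in Set.Ico (0 : ℝ) 1, Real.cos (a * (2 * Real.pi * k.2) +
          b * (2 * Real.pi * ((k.1 - k.2 : ℤ) : ℝ)) + θ) = 0 := fun a => by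
        refine (integral_congr_ae (ae_of_all _ fun b => ?_)).trans
          (integral_cos_period h (a * (2 * Real.pi * k.2) + θ))
        ring_nf
      simp_rw [h', integral_zero, mul_zero]

variable {k₀ θ : ℝ} {c : ℤ × ℤ → ℝ}

theorem integral_cell_trig (hk₀ : 0 < k₀) (hc : Summable fun k => |c k|) :
    ∫ x in cell k₀, trig k₀ θ c x = cellArea k₀ * (c 0 * Real.cos θ) := by
  have := isFiniteMeasure_cell hk₀
  have hint : ∀ k, Integrable (fun x => c k * Real.cos (inner ℝ (waveVec k₀ k) x + θ))
      (volume.restrict (cell k₀)) := fun k =>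
    Integrable.of_bound (by fun_prop) |c k| (ae_of_all _ fun x => norm_trig_term_le k₀ θ c k x)
  have hs : Summable fun k => ∫ x in cell k₀, ‖c k * Real.cos (inner ℝ (waveVec k₀ k) x + θ)‖ := by
    refine Summable.of_nonneg_of_le (fun k => integral_nonneg fun x => norm_nonneg _) (fun k => ?_)
      (hc.mul_right (cellArea k₀))
    refine (integral_mono (hint k).norm (integrable_const _)
      fun x => norm_trig_term_le k₀ θ c k x).trans ?_
    simp [volume_real_cell hk₀, mul_comm]
  have h := (integral_tsum_of_summable_integral_norm hint hs).symm
  unfold trig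
  rw [h, tsum_eq_single 0 fun k hk => by
    rw [integral_const_mul, integral_cell_cos hk₀, if_neg hk, mul_zero]]
  rw [integral_const_mul, integral_cell_cos hk₀, if_pos rfl]
  ring

theorem average_cell_trig (hk₀ : 0 < k₀) (hc : Summable fun k => |c k|) :
    ⨍ x in cell k₀, trig k₀ θ c x = c 0 * Real.cos θ := by
  rw [setAverage_eq, integral_cell_trig hk₀ hc, volume_real_cell hk₀, smul_eq_mul,
    inv_mul_cancel_left₀ (cellArea_pos hk₀).ne']

/-! ### Trigonometric series as members of the periodic Sobolev space. -/

theorem hexPeriodic_trig (hk₀ : 0 < k₀) (θ : ℝ) (c : ℤ × ℤ → ℝ) :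
    HexPeriodic k₀ (trig k₀ θ c) := by
  intro x
  constructor
  · refine tsum_congr fun k => ?_
    rw [inner_add_right, inner_waveVec_period₁ hk₀, ← Real.cos_add_int_mul_two_pi
      (inner ℝ (waveVec k₀ k) x + θ) k.2]
    ring_nf
  · refine tsum_congr fun k => ?_
    rw [inner_add_right, inner_waveVec_period₂ hk₀, ← Real.cos_add_int_mul_two_pi
      (inner ℝ (waveVec k₀ k) x + θ) (k.1 - k.2)]
    ring_nf

theorem memLp_trig (hk₀ : 0 < k₀) (hc : Summable fun k => |c k|) :
    MemLp (trig k₀ θ c) 2 (volume.restrict (cell k₀)) := by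
  have := isFiniteMeasure_cell hk₀
  exact MemLp.of_bound (continuous_trig hc).aestronglyMeasurable _
    (ae_of_all _ fun x => abs_trig_le hc x)

theorem Decays.memH2per (hk₀ : 0 < k₀) (h : Decays k₀ c) (θ : ℝ) :
    MemH2per k₀ (trig k₀ θ c) where
  continuous := continuous_trig h.summable
  periodic := hexPeriodic_trig hk₀ θ c
  memLp := memLp_trig hk₀ h.summable
  hasWeakDeriv i := (hasWeakDeriv_trig h.summable h.summable₁ i).hasWeakDeriv_weakDeriv
  memLp_weakDeriv i := (memLp_trig hk₀ (summable_derivCoeff h.summable₁ i)).ae_eq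
    (ae_restrict_of_ae (h.weakDeriv_ae_eq θ i).symm)
  hasWeakDeriv₂ i j := (h.hasWeakDeriv₂ θ i j).hasWeakDeriv_weakDeriv
  memLp_weakDeriv₂ i j := (memLp_trig hk₀ (summable_derivCoeff (h.summable₂ i) j)).ae_eq
    (ae_restrict_of_ae (h.weakDeriv₂_ae_eq θ i j).symm)

theorem Decays.normH2_eq (h : Decays k₀ c) :
    normH2 k₀ (trig k₀ 0 c) = √(∫ x in cell k₀, (trig k₀ 0 c x ^ 2
      + ∑ i, trig k₀ (0 + Real.pi / 2) (derivCoeff k₀ i c) x ^ 2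
      + ∑ i, ∑ j, trig k₀ (0 + Real.pi / 2 + Real.pi / 2)
          (derivCoeff k₀ j (derivCoeff k₀ i c)) x ^ 2)) := by
  rw [normH2]
  congr 1
  refine integral_congr_ae (ae_restrict_of_ae ?_)
  have h₁ := eventually_all.2 fun i => h.weakDeriv_ae_eq 0 i
  have h₂ := eventually_all.2 fun i => eventually_all.2 fun j => h.weakDeriv₂_ae_eq 0 i j
  filter_upwards [h₁, h₂] with x hx₁ hx₂
  simp_rw [hx₁, hx₂]

/-- The integrand has 1 + 2 + 4 = 7 squares, each bounded uniformly by the square of the weighted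
sum. -/
theorem Decays.normH2_le (hk₀ : 0 < k₀) (h : Decays k₀ c) :
    normH2 k₀ (trig k₀ 0 c) ≤
      √(7 * cellArea k₀) * ∑' k, (1 + ‖waveVec k₀ k‖ ^ 2) * |c k| := by
  have := isFiniteMeasure_cell hk₀
  set N := ∑' k, (1 + ‖waveVec k₀ k‖ ^ 2) * |c k| with hN
  have hN0 : 0 ≤ N := tsum_nonneg fun k => by positivity
  have key : ∀ (θ : ℝ) (d : ℤ × ℤ → ℝ), (∀ k, |d k| ≤ (1 + ‖waveVec k₀ k‖ ^ 2) * |c k|) →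
      ∀ x, trig k₀ θ d x ^ 2 ≤ N ^ 2 := fun θ d hd x => by
    have hd' : Summable fun k => |d k| := Summable.of_nonneg_of_le (fun _ => abs_nonneg _) hd h
    rw [← sq_abs]
    exact pow_le_pow_left₀ (abs_nonneg _)
      ((abs_trig_le hd' x).trans (hd'.tsum_le_tsum hd h)) 2
  have hb₀ := key 0 c fun k => by
    nlinarith [abs_nonneg (c k), mul_nonneg (sq_nonneg ‖waveVec k₀ k‖) (abs_nonneg (c k))]
  have hb₁ := fun i => key (0 + Real.pi / 2) (derivCoeff k₀ i c) fun k =>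
    (abs_derivCoeff_le k₀ i c k).trans (Decays.norm_mul_le k₀ c k)
  have hb₂ := fun i j => key (0 + Real.pi / 2 + Real.pi / 2)
    (derivCoeff k₀ j (derivCoeff k₀ i c)) fun k =>
    (abs_derivCoeff_le k₀ j _ k).trans (Decays.norm_mul_deriv_le k₀ c i k)
  rw [h.normH2_eq]
  refine Real.sqrt_le_iff.2 ⟨by positivity, ?_⟩
  rw [mul_pow, Real.sq_sqrt (mul_nonneg (by norm_num) (cellArea_pos hk₀).le)]
  refine (integral_mono_of_nonneg (ae_of_all _ fun x => by positivity)
    (integrable_const (7 * N ^ 2)) (ae_of_all _ fun x => ?_)).trans ?_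
  · simp only [Fin.sum_univ_two]
    linarith [hb₀ x, hb₁ 0 x, hb₁ 1 x, hb₂ 0 0 x, hb₂ 0 1 x, hb₂ 1 0 x, hb₂ 1 1 x]
  · rw [integral_const]
    simp only [MeasurableSet.univ, measureReal_restrict_apply, Set.univ_inter,
      volume_real_cell hk₀, smul_eq_mul]
    exact le_of_eq (by ring)

/-! ### The norm of the kernel element -/

/-- The lattice points of the six shortest wave vectors. -/
def hexPoints : Finset (ℤ × ℤ) := {(1, 0), (1, 1), (0, 1), (-1, 0), (-1, -1), (0, -1)}

theorem neg_mem_hexPoints {k : ℤ × ℤ} (hk : k ∈ hexPoints) : -k ∈ hexPoints := by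
  revert k; decide

theorem quadForm_of_mem_hexPoints {k : ℤ × ℤ} (hk : k ∈ hexPoints) :
    quadForm k = 1 := by
  revert k; decide

theorem mem_hexPoints {k : ℤ × ℤ} (h : quadForm k = 1) : k ∈ hexPoints := by
  obtain ⟨m, n⟩ := k
  simp only [quadForm] at h
  -- From `4 (m² - mn + n²) = 3 m² + (m - 2n)²`.
  have h1 : m ^ 2 ≤ 1 := by nlinarith [sq_nonneg (m - 2 * n)]
  have h2 : n ^ 2 ≤ 1 := by nlinarith [sq_nonneg (n - 2 * m)]
  have hm := abs_le.1 ((sq_le_one_iff_abs_le_one m).1 h1)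
  have hn := abs_le.1 ((sq_le_one_iff_abs_le_one n).1 h2)
  obtain ⟨hm1, hm2⟩ := hm
  obtain ⟨hn1, hn2⟩ := hn
  interval_cases m <;> interval_cases n <;> simp_all [hexPoints]

theorem decays_of_support {c : ℤ × ℤ → ℝ} (k₀ : ℝ) (s : Finset (ℤ × ℤ))
    (hc : ∀ k ∉ s, c k = 0) : Decays k₀ c :=
  summable_of_ne_finset_zero (s := s) fun k hk => by simp [hc k hk]

theorem trig_eq_sum {c : ℤ × ℤ → ℝ} (s : Finset (ℤ × ℤ)) (hc : ∀ k ∉ s, c k = 0) (x : Plane) :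
    trig k₀ θ c x = ∑ k ∈ s, c k * Real.cos (inner ℝ (waveVec k₀ k) x + θ) :=
  tsum_eq_sum fun k hk => by rw [hc k hk, zero_mul]

theorem integral_cell_cos_mul_cos (hk₀ : 0 < k₀) (k l : ℤ × ℤ) (θ : ℝ) :
    ∫ x in cell k₀, Real.cos (inner ℝ (waveVec k₀ k) x + θ) *
        Real.cos (inner ℝ (waveVec k₀ l) x + θ) =
      cellArea k₀ / 2 * ((if l = k then 1 else 0) + if l = -k then Real.cos (2 * θ) else 0) := by
  have := isFiniteMeasure_cell hk₀
  have hadd : ∀ x, inner ℝ (waveVec k₀ (k + l)) x =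
      inner ℝ (waveVec k₀ k) x + inner ℝ (waveVec k₀ l) x := fun x => by
    simp only [waveVec, Prod.fst_add, Prod.snd_add, Int.cast_add, add_smul, inner_add_left]
    ring
  have hsub : ∀ x, inner ℝ (waveVec k₀ (k - l)) x =
      inner ℝ (waveVec k₀ k) x - inner ℝ (waveVec k₀ l) x := fun x => by
    simp only [waveVec, Prod.fst_sub, Prod.snd_sub, Int.cast_sub, sub_smul, inner_add_left,
      inner_sub_left]
    ring
  have hprod : ∀ x, Real.cos (inner ℝ (waveVec k₀ k) x + θ) *
      Real.cos (inner ℝ (waveVec k₀ l) x + θ) =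
      1 / 2 * (Real.cos (inner ℝ (waveVec k₀ (k - l)) x + 0) +
        Real.cos (inner ℝ (waveVec k₀ (k + l)) x + 2 * θ)) := fun x => by
    have key : ∀ A B : ℝ, Real.cos A * Real.cos B =
        1 / 2 * (Real.cos (A - B) + Real.cos (A + B)) := fun A B => by
      rw [Real.cos_sub, Real.cos_add]; ring
    rw [key, hadd, hsub]
    ring_nf
  have hint : ∀ (m : ℤ × ℤ) (η : ℝ), Integrable
      (fun x => Real.cos (inner ℝ (waveVec k₀ m) x + η)) (volume.restrict (cell k₀)) :=
    fun m η => Integrable.of_bound (by fun_prop) 1 (ae_of_all _ fun x => Real.abs_cos_le_one _)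
  simp_rw [hprod]
  rw [integral_const_mul, integral_add (hint _ _) (hint _ _), integral_cell_cos hk₀,
    integral_cell_cos hk₀]
  simp only [sub_eq_zero, eq_comm (a := k), add_eq_zero_iff_neg_eq, eq_comm (a := -k),
    Real.cos_zero]
  split_ifs <;> ring

/-- The square integral of a finite trigonometric sum with symmetric frequency set. -/
theorem integral_cell_trig_sq (hk₀ : 0 < k₀) {s : Finset (ℤ × ℤ)} (hs : ∀ k ∈ s, -k ∈ s)
    (hc : ∀ k ∉ s, c k = 0) :
    ∫ x in cell k₀, trig k₀ θ c x ^ 2 =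
      cellArea k₀ / 2 * ∑ k ∈ s, (c k ^ 2 + Real.cos (2 * θ) * (c k * c (-k))) := by
  have := isFiniteMeasure_cell hk₀
  have hint : ∀ k l : ℤ × ℤ, Integrable (fun x => c k * c l *
      (Real.cos (inner ℝ (waveVec k₀ k) x + θ) * Real.cos (inner ℝ (waveVec k₀ l) x + θ)))
      (volume.restrict (cell k₀)) := fun k l =>
    (Integrable.of_bound (by fun_prop) 1 (ae_of_all _ fun x => by
      rw [norm_mul]
      exact mul_le_one₀ (Real.abs_cos_le_one _) (norm_nonneg _)
        (Real.abs_cos_le_one _))).const_mul _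
  have hsq : ∀ x, trig k₀ θ c x ^ 2 = ∑ k ∈ s, ∑ l ∈ s, c k * c l *
      (Real.cos (inner ℝ (waveVec k₀ k) x + θ) * Real.cos (inner ℝ (waveVec k₀ l) x + θ)) :=
    fun x => by
      rw [trig_eq_sum s hc, sq, Finset.sum_mul_sum]
      exact Finset.sum_congr rfl fun k _ => Finset.sum_congr rfl fun l _ => by ring
  simp_rw [hsq]
  rw [integral_finsetSum _ fun k _ => integrable_finsetSum _ fun l _ => hint k l, Finset.mul_sum]
  refine Finset.sum_congr rfl fun k hk => ?_
  rw [integral_finsetSum _ fun l _ => hint k l]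
  simp_rw [integral_const_mul, integral_cell_cos_mul_cos hk₀, mul_add, Finset.sum_add_distrib,
    mul_ite, mul_zero, Finset.sum_ite_eq', if_pos hk, if_pos (hs k hk)]
  ring

/-- The coefficients of the multiple `r • ψ₀` of the kernel element. -/
def hexCoeff (r : ℝ) (k : ℤ × ℤ) : ℝ := if k ∈ hexPoints then r else 0

theorem hexCoeff_of_notMem {r : ℝ} {k : ℤ × ℤ} (hk : k ∉ hexPoints) : hexCoeff r k = 0 :=
  if_neg hk

theorem smul_psi (k₀ r : ℝ) : r • psi k₀ = trig k₀ 0 (hexCoeff r) := by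
  ext x
  rw [trig_eq_sum hexPoints fun k hk => hexCoeff_of_notMem hk,
    Finset.sum_congr rfl fun k hk => by rw [hexCoeff, if_pos hk]]
  rw [hexPoints, Finset.sum_insert (by decide), Finset.sum_insert (by decide),
    Finset.sum_insert (by decide), Finset.sum_insert (by decide), Finset.sum_insert (by decide),
    Finset.sum_singleton, Pi.smul_apply, psi]
  simp only [waveVec, inner_add_left, real_inner_smul_left, smul_eq_mul, Int.cast_one,
    Int.cast_zero, Int.cast_neg, one_mul, zero_mul, neg_mul, add_zero, zero_add, Real.cos_neg]
  rw [← neg_add, Real.cos_neg]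
  ring

/-- For derivatives of order 0, 1, 2 the coefficients are even, odd, even in `k`, while `cos 2θ` is
1, -1, 1. So the terms pairing `k` with `-k` always double the diagonal ones. Summing over the
directions turns the three orders into `1`, `|k|² = k₀²` and `|k|⁴ = k₀⁴`. -/
theorem normH2_smul_psi (hk₀ : 0 < k₀) (r : ℝ) :
    normH2 k₀ (r • psi k₀) = |r| * √(6 * cellArea k₀ * (1 + k₀ ^ 2 + k₀ ^ 4)) := by
  have := isFiniteMeasure_cell hk₀
  have hd : Decays k₀ (hexCoeff r) := decays_of_support k₀ hexPoints fun k => hexCoeff_of_notMem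
  have hint : ∀ (θ : ℝ) (c : ℤ × ℤ → ℝ), (∀ k ∉ hexPoints, c k = 0) →
      Integrable (fun x => trig k₀ θ c x ^ 2) (volume.restrict (cell k₀)) := fun θ c hc =>
    (memLp_trig hk₀ (decays_of_support k₀ hexPoints hc).summable).integrable_sq
  have h0 : ∀ k ∉ hexPoints, hexCoeff r k = 0 := fun k => hexCoeff_of_notMem
  have h1 : ∀ i, ∀ k ∉ hexPoints, derivCoeff k₀ i (hexCoeff r) k = 0 := fun i k hk => by
    rw [derivCoeff, h0 k hk, mul_zero]
  have h2 : ∀ i j, ∀ k ∉ hexPoints, derivCoeff k₀ j (derivCoeff k₀ i (hexCoeff r)) k = 0 :=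
    fun i j k hk => by rw [derivCoeff, h1 i k hk, mul_zero]
  have hi₀ := hint 0 _ h0
  have hi₁ : Integrable (fun x => ∑ i, trig k₀ (0 + Real.pi / 2)
      (derivCoeff k₀ i (hexCoeff r)) x ^ 2) (volume.restrict (cell k₀)) :=
    integrable_finsetSum _ fun i _ => hint _ _ (h1 i)
  have hi₂ : ∀ i, Integrable (fun x => ∑ j, trig k₀ (0 + Real.pi / 2 + Real.pi / 2)
      (derivCoeff k₀ j (derivCoeff k₀ i (hexCoeff r))) x ^ 2) (volume.restrict (cell k₀)) :=
    fun i => integrable_finsetSum _ fun j _ => hint _ _ (h2 i j)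
  have hi₀₁ : Integrable (fun x => trig k₀ 0 (hexCoeff r) x ^ 2 + ∑ i, trig k₀ (0 + Real.pi / 2)
      (derivCoeff k₀ i (hexCoeff r)) x ^ 2) (volume.restrict (cell k₀)) := hi₀.add hi₁
  rw [smul_psi, hd.normH2_eq, integral_add hi₀₁ (integrable_finsetSum _ fun i _ => hi₂ i),
    integral_add hi₀ hi₁, integral_finsetSum _ fun i _ => hint _ _ (h1 i),
    integral_finsetSum _ fun i _ => hi₂ i]
  simp_rw [integral_finsetSum _ fun j _ => hint _ _ (h2 _ j)]
  rw [integral_cell_trig_sq hk₀ (fun k => neg_mem_hexPoints) h0]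
  simp_rw [fun i => integral_cell_trig_sq (θ := 0 + Real.pi / 2) hk₀
    (fun k => neg_mem_hexPoints) (h1 i),
    fun i j => integral_cell_trig_sq (θ := 0 + Real.pi / 2 + Real.pi / 2) hk₀
    (fun k => neg_mem_hexPoints) (h2 i j), Fin.sum_univ_two, ← mul_add, ← Finset.sum_add_distrib]
  rw [Finset.sum_congr rfl (g := fun _ => r ^ 2 * (2 * (1 + k₀ ^ 2 + k₀ ^ 4))) fun k hk => ?_]
  · rw [Finset.sum_const, show hexPoints.card = 6 from rfl, ← Real.sqrt_sq_eq_abs,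
      ← Real.sqrt_mul (sq_nonneg r)]
    congr 1
    simp
    ring
  · have hq := norm_waveVec_sq k₀ k
    rw [quadForm_of_mem_hexPoints hk, EuclideanSpace.norm_sq_eq, Fin.sum_univ_two] at hq
    simp only [Real.norm_eq_abs, sq_abs, Int.cast_one, mul_one] at hq
    have hn : ∀ i, waveVec k₀ (-k) i = -waveVec k₀ k i := fun i => by
      simp [waveVec]; ring
    have c1 : Real.cos (2 * (0 + Real.pi / 2)) = -1 := by
      rw [show 2 * (0 + Real.pi / 2) = Real.pi by ring, Real.cos_pi]
    have c2 : Real.cos (2 * (0 + Real.pi / 2 + Real.pi / 2)) = 1 := by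
      rw [show 2 * (0 + Real.pi / 2 + Real.pi / 2) = 2 * Real.pi by ring, Real.cos_two_pi]
    simp only [derivCoeff, hexCoeff, if_pos hk, if_pos (neg_mem_hexPoints hk), hn, c1, c2,
      mul_zero, Real.cos_zero]
    rw [show k₀ ^ 4 = (k₀ ^ 2) ^ 2 by ring, ← hq]
    ring

theorem normH2_psi (hk₀ : 0 < k₀) :
    normH2 k₀ (psi k₀) = √(6 * cellArea k₀ * (1 + k₀ ^ 2 + k₀ ^ 4)) := by
  simpa using normH2_smul_psi hk₀ 1

theorem normH2_psi_pos (hk₀ : 0 < k₀) : 0 < normH2 k₀ (psi k₀) := by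
  rw [normH2_psi hk₀]
  have := cellArea_pos hk₀
  positivity

theorem normH2_smul_psiHat (hk₀ : 0 < k₀) (r : ℝ) : normH2 k₀ (r • psiHat k₀) = |r| := by
  have h := normH2_psi_pos hk₀
  rw [psiHat, smul_smul, normH2_smul_psi hk₀, ← normH2_psi hk₀, abs_mul, abs_inv, abs_of_pos h,
    mul_assoc, inv_mul_cancel₀ h.ne', mul_one]

/-- Since `6 * cellArea k₀ = 16 √3 π² / k₀²`, the norm of `ψ₀` is four times the denominator of the
slope, and `critM` supplies the factor 4. -/
theorem slope_eq (hk₀ : 0 < k₀) (g : ℝ) :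
    slope g k₀ = 2 * critM g k₀ / normH2 k₀ (psi k₀) := by
  have h4 : ((3 : ℝ) ^ (1 / 4 : ℝ)) ^ 2 = √3 := by
    rw [← Real.rpow_natCast, ← Real.rpow_mul (by norm_num), Real.sqrt_eq_rpow]
    norm_num
  have h3 : √3 ^ 2 = 3 := Real.sq_sqrt (by norm_num)
  have h3' : √3 ≠ 0 := by positivity
  have hn : normH2 k₀ (psi k₀) =
      4 * ((3 : ℝ) ^ (1 / 4 : ℝ) * Real.pi * √(k₀ ^ 2 + 1 + 1 / k₀ ^ 2)) := by
    rw [normH2_psi hk₀]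
    refine (Real.sqrt_eq_iff_mul_self_eq (by have := cellArea_pos hk₀; positivity)
      (by positivity)).2 ?_
    have hs : √(k₀ ^ 2 + 1 + 1 / k₀ ^ 2) ^ 2 = k₀ ^ 2 + 1 + 1 / k₀ ^ 2 :=
      Real.sq_sqrt (by positivity)
    rw [← sq, mul_pow, mul_pow, mul_pow, h4, hs, cellArea]
    field_simp
    rw [h3]
    ring
  rw [hn, slope, critM]
  have : 0 < (3 : ℝ) ^ (1 / 4 : ℝ) * Real.pi * √(k₀ ^ 2 + 1 + 1 / k₀ ^ 2) := by positivity
  field_simp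

theorem slope_pos {g : ℝ} (hg : 0 < g) (hk₀ : 0 < k₀) : 0 < slope g k₀ := by
  unfold slope; positivity

end

section

/-! ### The algebra of symmetric sequences -/

theorem quadForm_eq_zero {k : ℤ × ℤ} (h : quadForm k = 0) : k = 0 := by
  unfold quadForm at h
  have h1 : k.1 ^ 2 ≤ 0 := by nlinarith [sq_nonneg (k.1 - 2 * k.2)]
  have h2 : k.2 ^ 2 ≤ 0 := by nlinarith [sq_nonneg (k.2 - 2 * k.1)]
  exact Prod.ext (pow_eq_zero_iff two_ne_zero |>.1 (le_antisymm h1 (sq_nonneg _)))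
    (pow_eq_zero_iff two_ne_zero |>.1 (le_antisymm h2 (sq_nonneg _)))

/-- The action of the rotation by `π/3` on the lattice points. -/
def rotIndex : ℤ × ℤ →+ ℤ × ℤ where
  toFun k := (k.2, k.2 - k.1)
  map_zero' := rfl
  map_add' k l := by ext <;> simp; ring

/-- The action of the reflection on the lattice points. -/
def reflIndex : ℤ × ℤ →+ ℤ × ℤ where
  toFun k := (k.1 - k.2, -k.2)
  map_zero' := rfl
  map_add' k l := by ext <;> simp <;> ring

theorem rotIndex_apply (k : ℤ × ℤ) : rotIndex k = (k.2, k.2 - k.1) := rfl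

theorem reflIndex_apply (k : ℤ × ℤ) : reflIndex k = (k.1 - k.2, -k.2) := rfl

theorem rotIndex_injective : Function.Injective rotIndex := fun k l h => by
  simp only [rotIndex_apply, Prod.mk.injEq] at h
  exact Prod.ext (by omega) h.1

theorem quadForm_rotIndex (k : ℤ × ℤ) : quadForm (rotIndex k) = quadForm k := by
  simp only [quadForm, rotIndex_apply]; ring

theorem quadForm_reflIndex (k : ℤ × ℤ) : quadForm (reflIndex k) = quadForm k := by
  simp only [quadForm, reflIndex_apply]; ring

theorem inner_waveVec (k₀ : ℝ) (k : ℤ × ℤ) (x : Plane) :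
    inner ℝ (waveVec k₀ k) x = k.1 * (k₀ * x 0) + k.2 * (k₀ / 2 * (√3 * x 1 - x 0)) := by
  simp [waveVec, waveVector₁, waveVector₂, PiLp.inner_apply, Fin.sum_univ_two]
  ring

/-- The rotation is moved to the wave vector as its transpose, so `rotIndex` is in fact the rotation
by `-π/3`. -/
theorem inner_waveVec_rot (k₀ : ℝ) (k : ℤ × ℤ) (x : Plane) :
    inner ℝ (waveVec k₀ k) (rot x) = inner ℝ (waveVec k₀ (rotIndex k)) x := by
  have h3 : √3 ^ 2 = 3 := Real.sq_sqrt (by norm_num)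
  rw [inner_waveVec, inner_waveVec, rotIndex_apply]
  simp [rot]
  linear_combination (k.2 : ℝ) * k₀ * x 0 / 4 * h3

theorem inner_waveVec_refl (k₀ : ℝ) (k : ℤ × ℤ) (x : Plane) :
    inner ℝ (waveVec k₀ k) (refl x) = inner ℝ (waveVec k₀ (reflIndex k)) x := by
  rw [inner_waveVec, inner_waveVec, reflIndex_apply]
  simp [refl]
  ring

/-! ### Pointwise evaluation and the symmetric subalgebra. -/

namespace Wiener

/-- The value at `x` of the cosine series of a sequence. -/
def cosEval (k₀ : ℝ) (x : Plane) : Wiener →L[ℝ] ℝ :=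
  lift (fun k => Real.cos (inner ℝ (waveVec k₀ k) x)) 1 fun _ => Real.abs_cos_le_one _

/-- The value at `x` of the sine series of a sequence. -/
def sinEval (k₀ : ℝ) (x : Plane) : Wiener →L[ℝ] ℝ :=
  lift (fun k => Real.sin (inner ℝ (waveVec k₀ k) x)) 1 fun _ => Real.abs_sin_le_one _

theorem cosEval_apply (k₀ : ℝ) (x : Plane) (a : Wiener) : cosEval k₀ x a = trig k₀ 0 a x := by
  simp [cosEval, lift_apply, trig]

theorem abs_cosEval_le (k₀ : ℝ) (x : Plane) (a : Wiener) : |cosEval k₀ x a| ≤ ‖a‖ := by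
  have h := (cosEval k₀ x).le_of_opNorm_le (norm_lift_le _ 1 zero_le_one _) a
  rwa [one_mul] at h

@[simp]
theorem cosEval_delta (k₀ : ℝ) (x : Plane) (k : ℤ × ℤ) :
    cosEval k₀ x (delta k) = Real.cos (inner ℝ (waveVec k₀ k) x) := lift_delta ..

@[simp]
theorem sinEval_delta (k₀ : ℝ) (x : Plane) (k : ℤ × ℤ) :
    sinEval k₀ x (delta k) = Real.sin (inner ℝ (waveVec k₀ k) x) := lift_delta ..

theorem cosEval_one (k₀ : ℝ) (x : Plane) : cosEval k₀ x 1 = 1 := by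
  rw [one_def, cosEval_delta]
  simp [waveVec]

/-- The addition theorem for the cosine on unit sequences, extended by `mul_ext`. -/
theorem cosEval_mul (k₀ : ℝ) (x : Plane) (a b : Wiener) :
    cosEval k₀ x (a * b) = cosEval k₀ x a * cosEval k₀ x b - sinEval k₀ x a * sinEval k₀ x b :=
  mul_ext (cosEval k₀ x)
    ((ContinuousLinearMap.mul ℝ ℝ).bilinearComp (cosEval k₀ x) (cosEval k₀ x) -
      (ContinuousLinearMap.mul ℝ ℝ).bilinearComp (sinEval k₀ x) (sinEval k₀ x))
    (fun k l => by
      simp only [cosEval_delta, sinEval_delta, sub_apply,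
        ContinuousLinearMap.bilinearComp_apply, ContinuousLinearMap.mul_apply']
      rw [← Real.cos_add, inner_waveVec, inner_waveVec, inner_waveVec]
      simp only [Prod.fst_add, Prod.snd_add, Int.cast_add]
      ring_nf) a b

/-- The closed subalgebra of sequences with the symmetry of the hexagonal lattice. -/
def symAlg : Subalgebra ℝ Wiener where
  carrier := {a | reindex rotIndex a = a ∧ reindex reflIndex a = a}
  mul_mem' {a b} ha hb := by
    simp only [Set.mem_ofPred_eq, reindex_mul] at ha hb ⊢
    rw [ha.1, ha.2, hb.1, hb.2]
    exact ⟨rfl, rfl⟩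
  add_mem' {a b} ha hb := by
    simp only [Set.mem_ofPred_eq, map_add] at ha hb ⊢
    rw [ha.1, ha.2, hb.1, hb.2]
    exact ⟨rfl, rfl⟩
  algebraMap_mem' r := by
    simp only [Set.mem_ofPred_eq, Algebra.algebraMap_eq_smul_one, map_smul, reindex_one, and_self]

theorem isClosed_symAlg : IsClosed (symAlg : Set Wiener) :=
  (isClosed_eq (reindex rotIndex).continuous continuous_id).inter
    (isClosed_eq (reindex reflIndex).continuous continuous_id)

/-- The cube of `rotIndex` is `k ↦ -k`, so symmetric sequences are even and the sine series equals
its own negative. This makes `cosEval` multiplicative on `symAlg`. -/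
theorem sinEval_eq_zero (k₀ : ℝ) (x : Plane) {a : Wiener} (ha : a ∈ symAlg) :
    sinEval k₀ x a = 0 := by
  have h : (sinEval k₀ x) ∘L (reindex rotIndex) ∘L (reindex rotIndex) ∘L (reindex rotIndex) =
      -sinEval k₀ x := clm_ext fun k => by
    simp only [ContinuousLinearMap.comp_apply, reindex_delta, sinEval_delta, neg_apply,
      inner_waveVec, rotIndex_apply, ← Real.sin_neg]
    push_cast
    ring_nf
  have h' := congrArg (fun f => f a) h
  simp only [ContinuousLinearMap.comp_apply, ha.1, neg_apply] at h'
  linarith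

theorem hexSymmetric_trig (k₀ : ℝ) {a : Wiener} (ha : a ∈ symAlg) :
    HexSymmetric (trig k₀ 0 a) := by
  intro x
  rw [← cosEval_apply, ← cosEval_apply, ← cosEval_apply]
  have h₁ : cosEval k₀ (rot x) = (cosEval k₀ x) ∘L (reindex rotIndex) := clm_ext fun k => by
    simp [inner_waveVec_rot]
  have h₂ : cosEval k₀ (refl x) = (cosEval k₀ x) ∘L (reindex reflIndex) := clm_ext fun k => by
    simp [inner_waveVec_refl]
  rw [h₁, h₂, ContinuousLinearMap.comp_apply, ContinuousLinearMap.comp_apply, ha.1, ha.2]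
  exact ⟨rfl, rfl⟩

end Wiener

open Wiener

/-- Symmetric absolutely summable sequences. -/
abbrev Sym : Type := Wiener.symAlg

namespace Sym

instance : CompleteSpace Sym := isClosed_symAlg.completeSpace_coe

/-- The inclusion of the symmetric sequences. -/
def incl : Sym →L[ℝ] Wiener := ⟨symAlg.val.toLinearMap, continuous_subtype_val⟩

/-- The coefficient at a lattice point. -/
def coeff (k : ℤ × ℤ) : Sym →L[ℝ] ℝ := Wiener.coeff k ∘L incl

theorem coeff_apply (k : ℤ × ℤ) (a : Sym) : coeff k a = (a : Wiener) k := rfl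

theorem ext_coeff {a b : Sym} (h : ∀ k, coeff k a = coeff k b) : a = b :=
  Subtype.ext (lp.ext (funext h))

theorem coeff_rotIndex (k : ℤ × ℤ) (a : Sym) : coeff (rotIndex k) a = coeff k a := by
  have h := reindex_apply rotIndex rotIndex_injective (a : Wiener) k
  rwa [a.2.1] at h

/-- The six points form one orbit of the rotation. Hence the kernel modes carry a single scalar
degree of freedom in `Sym`. -/
theorem coeff_of_mem_hexPoints {k : ℤ × ℤ} (hk : k ∈ hexPoints) (a : Sym) :
    coeff k a = coeff (1, 0) a := by
  have h₁ := coeff_rotIndex (1, 0) a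
  have h₂ := coeff_rotIndex (0, -1) a
  have h₃ := coeff_rotIndex (-1, -1) a
  have h₄ := coeff_rotIndex (-1, 0) a
  have h₅ := coeff_rotIndex (0, 1) a
  norm_num [rotIndex_apply] at h₁ h₂ h₃ h₄ h₅
  simp only [hexPoints, Finset.mem_insert, Finset.mem_singleton] at hk
  rcases hk with rfl | rfl | rfl | rfl | rfl | rfl
  · rfl
  · rw [h₅, h₄, h₃, h₂, h₁]
  · rw [h₄, h₃, h₂, h₁]
  · rw [h₃, h₂, h₁]
  · rw [h₂, h₁]
  · exact h₁

theorem coeff_one (k : ℤ × ℤ) : coeff k (1 : Sym) = if k = 0 then 1 else 0 :=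
  delta_apply 0 k

/-- The Fourier multiplier whose symbol is a function of the squared wave number. -/
def mult (f : ℤ → ℝ) (C : ℝ) (hf : ∀ q, |f q| ≤ C) : Sym →L[ℝ] Sym where
  toFun a := ⟨multiplier (fun k => f (quadForm k)) C (fun k => hf _) a, by
    have h : ∀ e : ℤ × ℤ →+ ℤ × ℤ, (∀ k, quadForm (e k) = quadForm k) →
        reindex e ∘L multiplier (fun k => f (quadForm k)) C (fun k => hf _) =
        multiplier (fun k => f (quadForm k)) C (fun k => hf _) ∘L reindex e :=
      fun e he => clm_ext fun k => by simp [he]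
    have h₁ := congrArg (fun f => f (a : Wiener)) (h rotIndex quadForm_rotIndex)
    have h₂ := congrArg (fun f => f (a : Wiener)) (h reflIndex quadForm_reflIndex)
    simp only [ContinuousLinearMap.comp_apply, a.2.1, a.2.2] at h₁ h₂
    exact ⟨h₁, h₂⟩⟩
  map_add' a b := Subtype.ext (map_add _ (a : Wiener) (b : Wiener))
  map_smul' r a := Subtype.ext (map_smul _ r (a : Wiener))
  cont := ((ContinuousLinearMap.continuous _).comp continuous_subtype_val).subtype_mk _

@[simp]
theorem coeff_mult (f : ℤ → ℝ) (C : ℝ) (hf : ∀ q, |f q| ≤ C) (k : ℤ × ℤ) (a : Sym) :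
    coeff k (mult f C hf a) = f (quadForm k) * coeff k a :=
  multiplier_apply (fun k => f (quadForm k)) C (fun _ => hf _) a k

/-- The sequence of the kernel element `ψ₀`. -/
def chi : Sym := ⟨∑ k ∈ hexPoints, delta k, by
  have h : ∀ e : ℤ × ℤ →+ ℤ × ℤ, hexPoints.image e = hexPoints → Set.InjOn e hexPoints →
      reindex e (∑ k ∈ hexPoints, delta k) = ∑ k ∈ hexPoints, delta k := fun e he hi => by
    rw [map_sum]
    simp_rw [reindex_delta]
    conv_rhs => rw [← he, Finset.sum_image hi]
  refine ⟨h rotIndex (by decide) rotIndex_injective.injOn, h reflIndex (by decide) ?_⟩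
  intro k _ l _ hkl
  simp only [reflIndex_apply, Prod.mk.injEq] at hkl
  exact Prod.ext (by omega) (by omega)⟩

theorem coe_chi : (chi : Wiener) = ∑ k ∈ hexPoints, delta k := rfl

theorem coeff_chi (k : ℤ × ℤ) : coeff k chi = if quadForm k = 1 then 1 else 0 := by
  have h : coeff k chi = ∑ l ∈ hexPoints, Wiener.coeff k (delta l) := by
    rw [coeff_apply, coe_chi, ← Wiener.coeff_apply, map_sum]
  simp only [h, Wiener.coeff_apply, delta_apply, Finset.sum_ite_eq]
  by_cases hk : k ∈ hexPoints
  · rw [if_pos hk, if_pos (quadForm_of_mem_hexPoints hk)]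
  · rw [if_neg hk, if_neg fun h => hk (mem_hexPoints h)]

/-- The resonance behind the transcritical bifurcation: `(1, 0) = (1, 1) + (0, -1)`, in two orders,
is the only way to write this point as a sum of two of the six. -/
theorem coeff_chi_mul_chi : coeff (1, 0) (chi * chi) = 2 := by
  have h : ((chi * chi : Sym) : Wiener) = ∑ k ∈ hexPoints, ∑ l ∈ hexPoints, delta (k + l) := by
    rw [show ((chi * chi : Sym) : Wiener) = (chi : Wiener) * (chi : Wiener) from rfl, coe_chi,
      Finset.sum_mul_sum]
    exact Finset.sum_congr rfl fun k _ => Finset.sum_congr rfl fun l _ => conv_delta k l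
  rw [coeff_apply, h, ← Wiener.coeff_apply, map_sum]
  simp_rw [map_sum, Wiener.coeff_apply, delta_apply]
  have h' : ∑ k ∈ hexPoints, ∑ l ∈ hexPoints, (if (1, 0) = k + l then 1 else 0 : ℕ) = 2 := by
    decide
  exact_mod_cast h'

/-- The value at `x` of the cosine series. -/
def eval (k₀ : ℝ) (x : Plane) : Sym →L[ℝ] ℝ := cosEval k₀ x ∘L incl

theorem eval_apply (k₀ : ℝ) (x : Plane) (a : Sym) :
    eval k₀ x a = trig k₀ 0 (a : Wiener) x := cosEval_apply ..

theorem abs_eval_le (k₀ : ℝ) (x : Plane) (a : Sym) : |eval k₀ x a| ≤ ‖a‖ := abs_cosEval_le ..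

theorem eval_one (k₀ : ℝ) (x : Plane) : eval k₀ x 1 = 1 := cosEval_one ..

theorem eval_mul (k₀ : ℝ) (x : Plane) (a b : Sym) :
    eval k₀ x (a * b) = eval k₀ x a * eval k₀ x b := by
  refine (cosEval_mul k₀ x a b).trans ?_
  rw [sinEval_eq_zero k₀ x a.2, zero_mul, sub_zero]
  rfl

theorem eval_pow (k₀ : ℝ) (x : Plane) (a : Sym) (n : ℕ) :
    eval k₀ x (a ^ n) = eval k₀ x a ^ n := by
  induction n with
  | zero => simp [eval_one]
  | succ n ih => rw [pow_succ, pow_succ, eval_mul, ih]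

theorem summable_coeff (a : Sym) : Summable fun k => |coeff k a| := summable_norm (a : Wiener)

theorem norm_eq (a : Sym) : ‖a‖ = ∑' k, |coeff k a| := Wiener.norm_eq (a : Wiener)

end Sym

end

section

/-! ### The nonlinearity as a power series -/

/-- The coefficients of the power series of `(nonlin r - nonlin 0) / r`. -/
def nonlinCoeff (n : ℕ) : ℝ :=
  (-1) ^ (n + 1) * (-1 / (n + 1) + (1 / 2) ^ (n + 1) / (n + 1) + (1 / 2) ^ (n + 2))

theorem nonlinCoeff_zero : nonlinCoeff 0 = 1 / 4 := by norm_num [nonlinCoeff]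

theorem nonlinCoeff_one : nonlinCoeff 1 = -1 / 4 := by norm_num [nonlinCoeff]

theorem abs_nonlinCoeff_le (n : ℕ) : |nonlinCoeff n| ≤ 3 := by
  have h₁ : |(-1 / (n + 1) : ℝ)| ≤ 1 := by
    rw [abs_div, abs_neg, abs_one, abs_of_pos (by positivity)]
    exact (div_le_one (by positivity)).2 (by linarith [Nat.cast_nonneg (α := ℝ) n])
  have hp : ∀ m : ℕ, (1 / 2 : ℝ) ^ m ≤ 1 := fun m => pow_le_one₀ (by norm_num) (by norm_num)
  have h₂ : |((1 / 2) ^ (n + 1) / (n + 1) : ℝ)| ≤ 1 := by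
    rw [abs_of_nonneg (by positivity)]
    exact (div_le_one (by positivity)).2
      (by linarith [Nat.cast_nonneg (α := ℝ) n, hp (n + 1)])
  have h₃ : |((1 / 2) ^ (n + 2) : ℝ)| ≤ 1 := by
    rw [abs_of_nonneg (by positivity)]
    exact hp _
  rw [nonlinCoeff, abs_mul, abs_pow, abs_neg, abs_one, one_pow, one_mul]
  linarith [abs_add_three (-1 / (n + 1) : ℝ) ((1 / 2) ^ (n + 1) / (n + 1)) ((1 / 2) ^ (n + 2))]

/-- The difference equals `log (1 + t) - log (1 + t/2) - (t/4) / (1 + t/2)`: two logarithmic series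
and one geometric series. -/
theorem hasSum_nonlin {t : ℝ} (ht : |t| < 1) :
    HasSum (fun n => t * (nonlinCoeff n * t ^ n)) (nonlin t - nonlin 0) := by
  obtain ⟨ht₁, ht₂⟩ := abs_lt.1 ht
  have ht' : |-t / 2| < 1 := by
    rw [abs_div, abs_neg, abs_two]; linarith [abs_nonneg t]
  have h₁ := Real.hasSum_pow_div_log_of_abs_lt_one (x := -t) (by rwa [abs_neg])
  have h₂ := Real.hasSum_pow_div_log_of_abs_lt_one ht'
  have h₃ := (hasSum_geometric_of_abs_lt_one ht').mul_left (-t / 2 / 2)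
  have hv : nonlin t - nonlin 0 = - -Real.log (1 - -t) + -Real.log (1 - -t / 2) +
      -t / 2 / 2 * (1 - -t / 2)⁻¹ := by
    have e : 1 - -t / 2 = (2 + t) / 2 := by ring
    rw [nonlin, nonlin, Real.log_div (by linarith) (by linarith), e,
      Real.log_div (by linarith) two_ne_zero, add_zero, add_zero,
      Real.log_div one_ne_zero two_ne_zero, Real.log_one, sub_neg_eq_add]
    have h2 : (2 : ℝ) + t ≠ 0 := by linarith
    field_simp
    ring
  rw [hv]
  refine Eq.subst (motive := fun f => HasSum f _) (funext fun n => ?_) ((h₁.neg.add h₂).add h₃)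
  have e₁ : (-t) ^ (n + 1) = (-1) ^ (n + 1) * t ^ (n + 1) := by rw [← mul_pow]; ring
  have e₂ : (-t / 2) ^ (n + 1) = (-1) ^ (n + 1) * t ^ (n + 1) * (1 / 2) ^ (n + 1) := by
    rw [← mul_pow, ← mul_pow]; ring
  have e₃ : -t / 2 / 2 * (-t / 2) ^ n = (-t / 2) ^ (n + 1) / 2 := by ring
  rw [e₃, e₁, e₂, nonlinCoeff]
  ring

namespace Sym

/-- The power series of `(nonlin r - nonlin 0) / r` in the algebra of symmetric sequences. -/
def nonlinSeries : FormalMultilinearSeries ℝ Sym Sym :=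
  FormalMultilinearSeries.ofScalars Sym nonlinCoeff

/-- The function `(nonlin r - nonlin 0) / r` on symmetric sequences. -/
def nonlinQuot (y : Sym) : Sym := nonlinSeries.sum y

theorem one_le_radius : 1 ≤ nonlinSeries.radius := by
  -- The norm bound for scalar series is applied only for `0 < n`, so the constant term enters the
  -- bound separately.
  refine nonlinSeries.le_radius_of_bound (r := 1) (max ‖nonlinSeries 0‖ 3) fun n => ?_
  rw [NNReal.coe_one, one_pow, mul_one]
  rcases n.eq_zero_or_pos with rfl | hn
  · exact le_max_left _ _
  · exact ((FormalMultilinearSeries.ofScalars_norm_le Sym nonlinCoeff n hn).trans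
      (abs_nonlinCoeff_le n)).trans (le_max_right _ _)

theorem hasFPowerSeriesOnBall_nonlinQuot :
    HasFPowerSeriesOnBall nonlinQuot nonlinSeries 0 nonlinSeries.radius :=
  nonlinSeries.hasFPowerSeriesOnBall (one_pos.trans_le one_le_radius)

theorem contDiffAt_nonlinQuot : ContDiffAt ℝ 1 nonlinQuot 0 :=
  hasFPowerSeriesOnBall_nonlinQuot.analyticAt.contDiffAt

theorem nonlinQuot_zero : nonlinQuot 0 = (1 / 4 : ℝ) • (1 : Sym) := by
  have h := FormalMultilinearSeries.ofScalarsSum_zero (E := Sym) (c := nonlinCoeff)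
  rw [nonlinCoeff_zero] at h
  exact h

theorem hasSum_nonlinQuot {y : Sym} (hy : ‖y‖ < 1) :
    HasSum (fun n => nonlinCoeff n • y ^ n) (nonlinQuot y) := by
  have hy' : y ∈ Metric.eball (0 : Sym) nonlinSeries.radius := by
    rw [Metric.mem_eball, edist_zero_right]
    refine lt_of_lt_of_le ?_ one_le_radius
    rw [← ofReal_norm]
    exact ENNReal.ofReal_lt_one.2 hy
  have h := hasFPowerSeriesOnBall_nonlinQuot.hasSum hy'
  rw [zero_add] at h
  exact Eq.subst (motive := fun f => HasSum f _) (funext fun n =>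
    FormalMultilinearSeries.ofScalars_apply_eq nonlinCoeff y n) h

theorem eval_mul_nonlinQuot (k₀ : ℝ) (x : Plane) {y : Sym} (hy : ‖y‖ < 1) :
    eval k₀ x (y * nonlinQuot y) = nonlin (eval k₀ x y) - nonlin 0 := by
  have h := ((hasSum_nonlinQuot hy).mapL (eval k₀ x)).mul_left (eval k₀ x y)
  simp only [map_smul, eval_pow, smul_eq_mul] at h
  rw [eval_mul]
  exact h.unique (hasSum_nonlin ((abs_eval_le k₀ x y).trans_lt hy))

theorem nonlinQuot_isBigO :
    (fun y : Sym => nonlinQuot y - ((1 / 4 : ℝ) • (1 : Sym) - (1 / 4 : ℝ) • y)) =O[𝓝 0]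
      fun y => ‖y‖ ^ 2 := by
  have h := hasFPowerSeriesOnBall_nonlinQuot.hasFPowerSeriesAt.isBigO_sub_partialSum_pow 2
  simp only [zero_add] at h
  refine h.congr_left fun y => ?_
  have h₀ := FormalMultilinearSeries.ofScalars_apply_eq nonlinCoeff y 0
  have h₁ := FormalMultilinearSeries.ofScalars_apply_eq nonlinCoeff y 1
  rw [FormalMultilinearSeries.partialSum, Finset.sum_range_succ, Finset.sum_range_one]
  simp only [nonlinSeries]
  rw [h₀, h₁, nonlinCoeff_zero, nonlinCoeff_one, pow_zero, pow_one]
  module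

end Sym

end

section

namespace Sym

/-! ### The reduced bifurcation equation -/

theorem abs_inv_mul_le (k₀ : ℝ) (q : ℤ) : |-(k₀ ^ 2 * (q : ℝ))⁻¹| ≤ (k₀ ^ 2)⁻¹ := by
  rw [abs_neg, mul_inv, abs_mul, abs_of_nonneg (by positivity : 0 ≤ (k₀ ^ 2)⁻¹)]
  refine mul_le_of_le_one_right (by positivity) ?_
  rw [abs_inv]
  -- At `q = 0` the convention `0⁻¹ = 0` makes the symbol vanish, so the inverse Laplacian also
  -- removes the mean.
  rcases eq_or_ne q 0 with rfl | hq
  · simp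
  · refine inv_le_one_of_one_le₀ ?_
    rw [← Int.cast_abs]
    exact_mod_cast Int.one_le_abs hq

/-- The inverse of the Laplacian on mean-zero sequences. -/
def invLap (k₀ : ℝ) : Sym →L[ℝ] Sym :=
  mult (fun q => -(k₀ ^ 2 * (q : ℝ))⁻¹) (k₀ ^ 2)⁻¹ (abs_inv_mul_le k₀)

/-- The projection onto mean-zero sequences. -/
def removeMean : Sym →L[ℝ] Sym :=
  mult (fun q => if q = 0 then 0 else 1) 1 fun q => by split_ifs <;> simp

/-- The projection onto the complement of the constants and of the kernel element. -/
def removeHex : Sym →L[ℝ] Sym :=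
  mult (fun q => if q = 0 ∨ q = 1 then 0 else 1) 1 fun q => by split_ifs <;> simp

/-- The symbol of the linearisation of the reduced equation. -/
def linSymbol (r : ℝ) (q : ℤ) : ℝ := if q = 0 then 1 else if q = 1 then r / 4 else 1 - (q : ℝ)⁻¹

/-- The spectral gap, from the integrality of `q`. Negative `q` is included because `mult` asks for
a bound of the symbol on all integers. -/
theorem linSymbol_bounds (q : ℤ) (h₀ : q ≠ 0) (h₁ : q ≠ 1) :
    1 / 2 ≤ 1 - (q : ℝ)⁻¹ ∧ 1 - (q : ℝ)⁻¹ ≤ 2 := by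
  rcases lt_or_gt_of_ne h₀ with h | h
  · have hq : (q : ℝ) ≤ -1 := by exact_mod_cast (by omega : q ≤ -1)
    have h1 : -1 ≤ (q : ℝ)⁻¹ := by
      rw [← neg_le_neg_iff, ← inv_neg, neg_neg]
      exact inv_le_one_of_one_le₀ (by linarith)
    have h2 : (q : ℝ)⁻¹ ≤ 0 := inv_nonpos.2 (by linarith)
    constructor <;> linarith
  · have hq : (2 : ℝ) ≤ q := by exact_mod_cast (by omega : 2 ≤ q)
    have h1 : (q : ℝ)⁻¹ ≤ 2⁻¹ := inv_anti₀ two_pos hq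
    have h2 : 0 ≤ (q : ℝ)⁻¹ := inv_nonneg.2 (by linarith)
    constructor <;> linarith

theorem abs_linSymbol_le (r : ℝ) (q : ℤ) : |linSymbol r q| ≤ 2 + |r / 4| := by
  unfold linSymbol
  split_ifs with h₀ h₁
  · rw [abs_one]; linarith [abs_nonneg (r / 4)]
  · linarith
  · obtain ⟨h, h'⟩ := linSymbol_bounds q h₀ h₁
    rw [abs_of_pos (by linarith)]; linarith [abs_nonneg (r / 4)]

theorem abs_linSymbol_inv_le (r : ℝ) (q : ℤ) : |(linSymbol r q)⁻¹| ≤ 2 + |(r / 4)⁻¹| := by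
  unfold linSymbol
  split_ifs with h₀ h₁
  · rw [inv_one, abs_one]; linarith [abs_nonneg (r / 4)⁻¹]
  · linarith
  · obtain ⟨h, h'⟩ := linSymbol_bounds q h₀ h₁
    rw [abs_of_pos (by positivity)]
    have := inv_anti₀ (by norm_num) h
    norm_num at this
    linarith [abs_nonneg (r / 4)⁻¹]

theorem linSymbol_ne_zero {r : ℝ} (hr : r ≠ 0) (q : ℤ) : linSymbol r q ≠ 0 := by
  unfold linSymbol
  split_ifs with h₀ h₁
  · exact one_ne_zero
  · simpa using hr
  · linarith [(linSymbol_bounds q h₀ h₁).1]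

/-- The linearisation of the reduced equation. -/
def lin (r : ℝ) : Sym →L[ℝ] Sym := mult (linSymbol r) _ (abs_linSymbol_le r)

theorem isInvertible_lin {r : ℝ} (hr : r ≠ 0) : (lin r).IsInvertible := by
  refine ⟨ContinuousLinearEquiv.equivOfInverse (lin r)
    (mult (fun q => (linSymbol r q)⁻¹) _ (abs_linSymbol_inv_le r)) (fun a => ?_) (fun a => ?_), rfl⟩
  · exact ext_coeff fun k => by
      rw [lin, coeff_mult, coeff_mult, inv_mul_cancel_left₀ (linSymbol_ne_zero hr _)]
  · exact ext_coeff fun k => by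
      rw [lin, coeff_mult, coeff_mult, mul_inv_cancel_left₀ (linSymbol_ne_zero hr _)]

/-- The Laplacian of the profile with the free component `b`. -/
def lapProfile (k₀ r : ℝ) (b : Sym) : Sym := -(k₀ ^ 2 * r) • chi + removeHex b

/-- The profile `r ψ₀ + z` of a solution, where `z` is given by the free component `b`. -/
def profile (k₀ r : ℝ) (b : Sym) : Sym := invLap k₀ (lapProfile k₀ r b)

/-- The bifurcation equation divided by the amplitude. The coefficient of the unknown at the first
wave vector is the deviation of the parameter, and its mean is forced to vanish. -/
def reduced (g k₀ r : ℝ) (p : ℝ × Sym) : Sym :=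
  lapProfile k₀ r p.2 - g • profile k₀ r p.2 +
    (critM g k₀ + coeff (1, 0) p.2) •
      removeMean (profile k₀ r p.2 * nonlinQuot (p.1 • profile k₀ r p.2)) +
    coeff 0 p.2 • (1 : Sym)

theorem coeff_lapProfile (k₀ r : ℝ) (b : Sym) (k : ℤ × ℤ) :
    coeff k (lapProfile k₀ r b) = -(k₀ ^ 2 * r) * (if quadForm k = 1 then 1 else 0) +
      (if quadForm k = 0 ∨ quadForm k = 1 then 0 else 1) * coeff k b := by
  rw [lapProfile, map_add, map_smul, coeff_chi, removeHex, coeff_mult, smul_eq_mul]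

theorem coeff_profile (k₀ r : ℝ) (b : Sym) (k : ℤ × ℤ) :
    coeff k (profile k₀ r b) =
      -(k₀ ^ 2 * (quadForm k : ℝ))⁻¹ * coeff k (lapProfile k₀ r b) := by
  rw [profile, invLap, coeff_mult]

theorem profile_eq {k₀ : ℝ} (hk₀ : 0 < k₀) (r : ℝ) (b : Sym) :
    profile k₀ r b = r • chi + invLap k₀ (removeHex b) := by
  rw [profile, lapProfile, map_add, map_smul]
  congr 1
  refine ext_coeff fun k => ?_
  rw [invLap, map_smul, map_smul, coeff_mult, coeff_chi]
  split_ifs with h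
  · rw [h]
    simp only [smul_eq_mul, Int.cast_one, mul_one]
    field_simp
  · simp

theorem contDiff_lapProfile (k₀ r : ℝ) : ContDiff ℝ 1 (lapProfile k₀ r) :=
  contDiff_const.add removeHex.contDiff

theorem contDiff_profile (k₀ r : ℝ) : ContDiff ℝ 1 (profile k₀ r) :=
  (invLap k₀).contDiff.comp (contDiff_lapProfile k₀ r)

theorem contDiffAt_reduced (g k₀ r : ℝ) : ContDiffAt ℝ 1 (reduced g k₀ r) (0, 0) := by
  have hl : ContDiffAt ℝ 1 (fun p : ℝ × Sym => lapProfile k₀ r p.2) (0, 0) :=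
    ((contDiff_lapProfile k₀ r).comp contDiff_snd).contDiffAt
  have hp : ContDiffAt ℝ 1 (fun p : ℝ × Sym => profile k₀ r p.2) (0, 0) :=
    ((contDiff_profile k₀ r).comp contDiff_snd).contDiffAt
  have hc : ∀ k, ContDiffAt ℝ 1 (fun p : ℝ × Sym => coeff k p.2) (0, 0) := fun k =>
    ((coeff k).contDiff.comp contDiff_snd).contDiffAt
  have hn : ContDiffAt ℝ 1 (fun p : ℝ × Sym => nonlinQuot (p.1 • profile k₀ r p.2)) (0, 0) := by
    -- The factor `s = 0` places the argument at the centre of the power series, whatever the size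
    -- of the profile.
    refine ContDiffAt.comp (g := nonlinQuot) (0, 0) ?_ (contDiffAt_fst.smul hp)
    rw [zero_smul]
    exact contDiffAt_nonlinQuot
  exact ((hl.sub (hp.const_smul g)).add ((contDiffAt_const.add (hc _)).smul
    (removeMean.contDiff.contDiffAt.comp _ (hp.mul hn)))).add ((hc _).smul contDiffAt_const)

theorem reduced_zero_left (g k₀ r : ℝ) (b : Sym) :
    reduced g k₀ r (0, b) = lapProfile k₀ r b - g • profile k₀ r b +
      ((critM g k₀ + coeff (1, 0) b) • ((1 / 4 : ℝ) • removeMean (profile k₀ r b))) +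
      coeff 0 b • (1 : Sym) := by
  simp only [reduced, zero_smul, nonlinQuot_zero, mul_smul_comm, mul_one, map_smul]

/-- At the mean only the slack term survives. At the kernel modes only the variation of the
parameter survives, multiplied by `r ψ₀ / 4`. At every other mode `critM / 4 = g + k₀²` turns the
symbol into `1 - 1/q`. -/
theorem hasFDerivAt_reduced_zero_left (g r : ℝ) {k₀ : ℝ} (hk₀ : 0 < k₀) :
    HasFDerivAt (fun b => reduced g k₀ r (0, b)) (lin r) 0 := by
  simp_rw [reduced_zero_left]
  have hl : HasFDerivAt (lapProfile k₀ r) removeHex 0 := removeHex.hasFDerivAt.const_add _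
  have hp : HasFDerivAt (profile k₀ r) (invLap k₀ ∘L removeHex) 0 :=
    (invLap k₀).hasFDerivAt.comp 0 hl
  have hc : ∀ k, HasFDerivAt (fun b : Sym => coeff k b) (coeff k) 0 := fun k =>
    (coeff k).hasFDerivAt
  have h := ((hl.sub (hp.const_smul g)).add (((hc (1, 0)).const_add (critM g k₀)).smul
    ((removeMean.hasFDerivAt.comp 0 hp).const_smul (1 / 4 : ℝ)))).add
    ((hc 0).smul_const (1 : Sym))
  refine h.congr_fderiv ?_
  ext1 b
  refine ext_coeff fun k => ?_
  simp only [add_apply, sub_apply, smul_apply, ContinuousLinearMap.comp_apply,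
    ContinuousLinearMap.smulRight_apply, Pi.smul_apply, Function.comp_apply, map_add, map_sub,
    map_smul, smul_eq_mul, coeff_one, map_zero, add_zero, removeMean, removeHex, invLap, lin,
    coeff_mult, coeff_profile, coeff_lapProfile, linSymbol, critM]
  by_cases h0 : quadForm k = 0
  · have := quadForm_eq_zero h0
    subst this
    simp [h0]
  · have hk : k ≠ 0 := fun h => h0 (by rw [h]; rfl)
    by_cases h1 : quadForm k = 1
    · rw [coeff_of_mem_hexPoints (mem_hexPoints h1) b]
      simp only [h1, hk, Int.cast_one, mul_one, one_ne_zero, if_false, if_true, or_true]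
      field_simp
      ring
    · have hq : (quadForm k : ℝ) ≠ 0 := by exact_mod_cast h0
      simp only [h0, h1, hk, or_self, if_false]
      field_simp
      ring

theorem reduced_zero (g r : ℝ) {k₀ : ℝ} (hk₀ : 0 < k₀) : reduced g k₀ r (0, 0) = 0 := by
  rw [reduced_zero_left]
  refine ext_coeff fun k => ?_
  simp only [map_add, map_sub, map_smul, smul_eq_mul, map_zero, add_zero, removeMean, coeff_mult,
    coeff_profile, coeff_lapProfile, critM, zero_mul, mul_zero]
  by_cases h1 : quadForm k = 1
  · simp only [h1, if_true, one_ne_zero, if_false, Int.cast_one]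
    field_simp
    ring
  · simp [h1]

/-- The solution curve of the reduced equation. -/
theorem exists_branch (g : ℝ) {k₀ r : ℝ} (hk₀ : 0 < k₀) (hr : r ≠ 0) :
    ∃ b : ℝ → Sym, b 0 = 0 ∧ (∀ᶠ s in 𝓝 0, reduced g k₀ r (s, b s) = 0) ∧
      (∀ᶠ s in 𝓝 0, ContinuousAt b s) ∧ b =O[𝓝 0] fun s : ℝ => s := by
  have hC := contDiffAt_reduced g k₀ r
  -- By the chain rule along `b ↦ (0, b)`, this composition is the partial derivative in `b`.
  have hd : fderiv ℝ (reduced g k₀ r) (0, 0) ∘L .inr ℝ ℝ Sym = lin r := by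
    have h : HasFDerivAt (fun b : Sym => ((0 : ℝ), b)) (.inr ℝ ℝ Sym) 0 :=
      hasFDerivAt_prodMk_right 0 0
    have h' := (hC.differentiableAt one_ne_zero).hasFDerivAt.comp (0 : Sym) h
    exact h'.unique (hasFDerivAt_reduced_zero_left g r hk₀)
  have hi : (fderiv ℝ (reduced g k₀ r) (0, 0) ∘L .inr ℝ ℝ Sym).IsInvertible := by
    rw [hd]; exact isInvertible_lin hr
  have h0 := hC.implicitFunction_apply_self one_ne_zero hi
  have hb := hC.contDiffAt_implicitFunction one_ne_zero hi
  refine ⟨hC.implicitFunction one_ne_zero hi, h0, ?_, ?_, ?_⟩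
  · filter_upwards [hC.eventually_apply_implicitFunction one_ne_zero hi] with s hs
    rw [hs, reduced_zero g r hk₀]
  · filter_upwards [hb.eventually (by simp)] with s hs using hs.continuousAt
  · have := (hb.differentiableAt one_ne_zero).isBigO_sub
    simpa [h0] using this

end Sym

end

section

namespace Sym

/-! ### From sequences to functions -/

/-- The cosine series of a symmetric sequence. -/
def series (k₀ : ℝ) (a : Sym) : Plane → ℝ := trig k₀ 0 (a : Wiener)

theorem series_apply (k₀ : ℝ) (a : Sym) (x : Plane) : series k₀ a x = eval k₀ x a :=
  (eval_apply k₀ x a).symm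

theorem series_sub (k₀ : ℝ) (a b : Sym) : series k₀ (a - b) = series k₀ a - series k₀ b := by
  ext x
  simp only [Pi.sub_apply, series_apply, map_sub]

theorem series_smul_chi (k₀ r : ℝ) : series k₀ (r • chi) = r • psi k₀ := by
  rw [smul_psi]
  refine congrArg (trig k₀ 0) (funext fun k => ?_)
  have h : coeff k (r • chi) = hexCoeff r k := by
    rw [map_smul, coeff_chi, hexCoeff]
    by_cases hk : k ∈ hexPoints
    · simp [hk, quadForm_of_mem_hexPoints hk]
    · rw [if_neg hk, if_neg fun h => hk (mem_hexPoints h), smul_zero]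
  exact h

theorem quadForm_nonneg (k : ℤ × ℤ) : 0 ≤ quadForm k := by
  unfold quadForm
  nlinarith [sq_nonneg (k.1 - k.2), sq_nonneg k.1, sq_nonneg k.2]

/-- Inverting the Laplacian gains two derivatives: its symbol absorbs the weight `1 + |k|²`, so no
decay of `a` beyond summability is needed. -/
theorem weight_mul_coeff_invLap_le (k₀ : ℝ) (a : Sym) (k : ℤ × ℤ) :
    (1 + ‖waveVec k₀ k‖ ^ 2) * |coeff k (invLap k₀ a)| ≤ ((k₀ ^ 2)⁻¹ + 1) * |coeff k a| := by
  have hq : (0 : ℝ) ≤ quadForm k := by exact_mod_cast quadForm_nonneg k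
  rw [invLap, coeff_mult, abs_mul, ← mul_assoc, norm_waveVec_sq]
  refine mul_le_mul_of_nonneg_right ?_ (abs_nonneg _)
  rw [add_mul, one_mul]
  refine add_le_add (abs_inv_mul_le k₀ _) ?_
  rw [abs_neg, abs_of_nonneg (by positivity)]
  exact mul_inv_le_one

theorem decays_invLap (k₀ : ℝ) (a : Sym) : Decays k₀ ((invLap k₀ a : Sym) : Wiener) :=
  Summable.of_nonneg_of_le (fun _ => by positivity) (weight_mul_coeff_invLap_le k₀ a)
    ((summable_coeff a).mul_left _)

theorem normH2_series_invLap_le {k₀ : ℝ} (hk₀ : 0 < k₀) (a : Sym) :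
    normH2 k₀ (series k₀ (invLap k₀ a)) ≤
      √(7 * cellArea k₀) * (((k₀ ^ 2)⁻¹ + 1) * ‖a‖) := by
  refine ((decays_invLap k₀ a).normH2_le hk₀).trans ?_
  refine mul_le_mul_of_nonneg_left ?_ (Real.sqrt_nonneg _)
  rw [norm_eq, ← tsum_mul_left]
  exact (decays_invLap k₀ a).tsum_le_tsum (weight_mul_coeff_invLap_le k₀ a)
    ((summable_coeff a).mul_left _)

theorem average_series {k₀ : ℝ} (hk₀ : 0 < k₀) (a : Sym) :
    ⨍ x in cell k₀, series k₀ a x = coeff 0 a := by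
  refine (average_cell_trig hk₀ (summable_coeff a)).trans ?_
  rw [Real.cos_zero, mul_one]

theorem series_invLap_mem_setU {k₀ : ℝ} (hk₀ : 0 < k₀) (a : Sym) (ha : ‖invLap k₀ a‖ < 1) :
    series k₀ (invLap k₀ a) ∈ setU k₀ := by
  refine ⟨⟨(decays_invLap k₀ a).memH2per hk₀ 0,
    Wiener.hexSymmetric_trig k₀ (invLap k₀ a).2, ?_⟩, fun x => ?_⟩
  · rw [average_series hk₀, invLap, coeff_mult]
    simp [quadForm]
  · rw [series_apply]
    exact (abs_lt.1 ((abs_eval_le k₀ x _).trans_lt ha)).1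

theorem weakLaplacian_series_invLap {k₀ : ℝ} (hk₀ : 0 < k₀) {a : Sym} (ha : coeff 0 a = 0) :
    weakLaplacian (series k₀ (invLap k₀ a)) =ᵐ[volume] series k₀ a := by
  refine ((decays_invLap k₀ a).weakLaplacian_ae_eq 0).trans (Eq.eventuallyEq ?_)
  refine congrArg (trig k₀ 0) (funext fun k => ?_)
  change -(‖waveVec k₀ k‖ ^ 2 * coeff k (invLap k₀ a)) = coeff k a
  rw [invLap, coeff_mult, norm_waveVec_sq]
  by_cases h0 : quadForm k = 0
  · rw [quadForm_eq_zero h0, ha]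
    simp
  · have hq : (quadForm k : ℝ) ≠ 0 := by exact_mod_cast h0
    field_simp

theorem removeMean_eq (a : Sym) : removeMean a = a - coeff 0 a • (1 : Sym) := by
  refine ext_coeff fun k => ?_
  rw [removeMean, coeff_mult, map_sub, map_smul, coeff_one]
  by_cases hk : k = 0
  · simp [hk, quadForm]
  · have h0 : quadForm k ≠ 0 := fun h => hk (quadForm_eq_zero h)
    simp [hk, h0]

theorem meanK_series {k₀ : ℝ} (hk₀ : 0 < k₀) {y : Sym} (hy : ‖y‖ < 1) :
    meanK k₀ (series k₀ y) = coeff 0 (y * nonlinQuot y) + nonlin 0 := by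
  have hf : ∀ x, nonlin (series k₀ y x) =
      series k₀ (y * nonlinQuot y + nonlin 0 • (1 : Sym)) x := fun x => by
    rw [series_apply, series_apply, map_add, eval_mul_nonlinQuot k₀ x hy, map_smul, eval_one,
      smul_eq_mul]
    ring
  rw [meanK]
  simp_rw [hf]
  rw [average_series hk₀, map_add, map_smul, coeff_one, if_pos rfl, smul_eq_mul, mul_one]

/-- Solutions of the equation for sequences are solutions of the differential equation. -/
theorem isSolution_series {g k₀ M : ℝ} (hk₀ : 0 < k₀) {a : Sym} (ha : coeff 0 a = 0)
    (hy : ‖invLap k₀ a‖ < 1)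
    (h : a - g • invLap k₀ a + M • removeMean (invLap k₀ a * nonlinQuot (invLap k₀ a)) = 0) :
    IsSolution g k₀ (series k₀ (invLap k₀ a)) M := by
  filter_upwards [weakLaplacian_series_invLap hk₀ ha] with x hx
  have hx' := congrArg (eval k₀ x) h
  rw [removeMean_eq] at hx'
  simp only [map_add, map_sub, map_smul, smul_eq_mul, map_zero, eval_one,
    eval_mul_nonlinQuot k₀ x hy] at hx'
  rw [bifF, hx, meanK_series hk₀ hy, series_apply, series_apply, Pi.zero_apply]
  linarith

/-! ### The solution branch -/

theorem coeff_zero_lapProfile (k₀ r : ℝ) (b : Sym) : coeff 0 (lapProfile k₀ r b) = 0 := by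
  simp [coeff_lapProfile, quadForm]

/-- All terms of `reduced` except the slack term have mean zero. -/
theorem coeff_zero_eq_zero {g k₀ r s : ℝ} {b : Sym} (h : reduced g k₀ r (s, b) = 0) :
    coeff 0 b = 0 := by
  have h' := congrArg (coeff 0) h
  simp only [reduced, map_add, map_sub, map_smul, smul_eq_mul, coeff_zero_lapProfile,
    coeff_profile, removeMean, coeff_mult, coeff_one, map_zero] at h'
  simpa [quadForm] using h'

/-- Multiplying the reduced equation by `s` restores the equation for the profile of amplitude `s`,
once the slack term is known to vanish. -/
theorem isSolution_of_reduced {g k₀ r s : ℝ} (hk₀ : 0 < k₀) {b : Sym}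
    (h : reduced g k₀ r (s, b) = 0) (hs : ‖invLap k₀ (s • lapProfile k₀ r b)‖ < 1) :
    IsSolution g k₀ (series k₀ (invLap k₀ (s • lapProfile k₀ r b)))
      (critM g k₀ + coeff (1, 0) b) := by
  refine isSolution_series hk₀ (by rw [map_smul, coeff_zero_lapProfile, smul_zero]) hs ?_
  have hb := coeff_zero_eq_zero h
  have h' := congrArg (s • ·) h
  simp only [reduced, hb, zero_smul, add_zero, smul_zero] at h'
  rw [map_smul]
  change s • lapProfile k₀ r b - g • s • profile k₀ r b + (critM g k₀ + coeff (1, 0) b) •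
    removeMean (s • profile k₀ r b * nonlinQuot (s • profile k₀ r b)) = 0
  rw [smul_mul_assoc, map_smul, ← h']
  module

variable {b : ℝ → Sym}

theorem profile_sub_isBigO {k₀ : ℝ} (hk₀ : 0 < k₀) (r : ℝ) (hb : b =O[𝓝 0] fun s : ℝ => s) :
    (fun s => profile k₀ r (b s) - r • chi) =O[𝓝 0] fun s : ℝ => s := by
  simp_rw [profile_eq hk₀, add_sub_cancel_left]
  exact (((invLap k₀) ∘L removeHex).isBigO_comp b _).trans hb

theorem coeff_isBigO {α : Type*} {l : Filter α} {f : α → Sym} {u : α → ℝ} (k : ℤ × ℤ)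
    (h : f =O[l] u) : (fun s => coeff k (f s)) =O[l] u :=
  ((coeff k).isBigO_comp f l).trans h

/-- The first wave vector component of the nonlinear term along the branch. -/
theorem coeff_nonlinear_isBigO {k₀ : ℝ} (hk₀ : 0 < k₀) (r : ℝ)
    (hb : b =O[𝓝 0] fun s : ℝ => s) :
    (fun s => coeff (1, 0) (profile k₀ r (b s) * nonlinQuot (s • profile k₀ r (b s))) -
      (r / 4 - s * r ^ 2 / 2)) =O[𝓝 0] fun s : ℝ => s ^ 2 := by
  set u : ℝ → Sym := fun s => profile k₀ r (b s) with hu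
  have hz : (fun s => u s - r • chi) =O[𝓝 0] fun s : ℝ => s := profile_sub_isBigO hk₀ r hb
  have hid : (fun s : ℝ => s) =O[𝓝 0] fun _ : ℝ => (1 : ℝ) := by
    have : Tendsto (fun s : ℝ => s) (𝓝 0) (𝓝 0) := tendsto_id
    exact this.isBigO_one ℝ
  have hu1 : u =O[𝓝 0] fun _ : ℝ => (1 : ℝ) := by
    have := (hz.trans hid).add (isBigO_const_const (r • chi : Sym) (one_ne_zero (α := ℝ)) (𝓝 0))
    simpa using this
  have hsu : (fun s : ℝ => s • u s) =O[𝓝 0] fun s : ℝ => s := by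
    simpa using (isBigO_refl (fun s : ℝ => s) (𝓝 0)).smul hu1
  have hsu0 : Tendsto (fun s : ℝ => s • u s) (𝓝 0) (𝓝 0) := hsu.trans_tendsto tendsto_id
  have hE : (fun s : ℝ => nonlinQuot (s • u s) -
      ((1 / 4 : ℝ) • (1 : Sym) - (1 / 4 : ℝ) • s • u s)) =O[𝓝 0] fun s : ℝ => s ^ 2 :=
    (nonlinQuot_isBigO.comp_tendsto hsu0).trans (hsu.norm_left.pow 2)
  have h₁ : (fun s => coeff (1, 0) (u s * (nonlinQuot (s • u s) -
      ((1 / 4 : ℝ) • (1 : Sym) - (1 / 4 : ℝ) • s • u s)))) =O[𝓝 0] fun s : ℝ => s ^ 2 := by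
    simpa using coeff_isBigO (1, 0) (hu1.mul hE)
  -- The bracket is `u² - r² χ²` factored to display `u - r χ = O(s)`; with the prefactor `s / 4`
  -- the term is quadratic.
  have h₂ : (fun s => coeff (1, 0) ((s / 4) • ((u s - r • chi) * u s +
      r • chi * (u s - r • chi)))) =O[𝓝 0] fun s : ℝ => s ^ 2 := by
    refine coeff_isBigO (1, 0) ?_
    have h3 : (fun s : ℝ => (u s - r • chi) * u s + r • chi * (u s - r • chi)) =O[𝓝 0]
        fun s : ℝ => s := by
      refine IsBigO.add ?_ (hz.const_mul_left _)
      simpa using hz.mul hu1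
    have h4 : (fun s : ℝ => s / 4) =O[𝓝 0] fun s : ℝ => s := by
      simpa [div_eq_inv_mul] using (isBigO_refl (fun s : ℝ => s) (𝓝 0)).const_mul_left (4⁻¹ : ℝ)
    simpa [sq] using h4.smul h3
  refine (h₁.sub h₂).congr_left fun s => ?_
  -- Exact, without remainder: `removeHex` keeps the free component off the kernel modes.
  have hc : coeff (1, 0) (u s) = r := by
    rw [hu]
    simp only [coeff_profile, coeff_lapProfile]
    simp [quadForm]
    field_simp
  have e : u s * nonlinQuot (s • u s) = u s * (nonlinQuot (s • u s) -
      ((1 / 4 : ℝ) • (1 : Sym) - (1 / 4 : ℝ) • s • u s)) +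
      ((1 / 4 : ℝ) • u s - (s / 4) • (u s * u s)) := by
    simp only [mul_sub, mul_smul_comm, mul_one]
    module
  have e' : (u s - r • chi) * u s + r • chi * (u s - r • chi) =
      u s * u s - r ^ 2 • (chi * chi) := by
    simp only [sub_mul, mul_sub, smul_mul_assoc, mul_smul_comm]
    module
  rw [e, e', map_add, map_sub, map_smul, map_smul, map_smul, map_sub, map_smul, hc,
    coeff_chi_mul_chi]
  simp only [smul_eq_mul]
  ring

/-- At `k₁` the reduced equation reads `(M* + β) A = M* r / 4`, where `A = r/4 - s r²/2 + O(s²)` is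
the nonlinear coefficient. Solving for `β`, which is itself `O(s)`, gives the slope. -/
theorem coeff_parameter_isBigO {g k₀ r : ℝ} (hk₀ : 0 < k₀) (hr : r ≠ 0)
    (hb : b =O[𝓝 0] fun s : ℝ => s) (h : ∀ᶠ s in 𝓝 0, reduced g k₀ r (s, b s) = 0) :
    (fun s => coeff (1, 0) (b s) - 2 * critM g k₀ * r * s) =O[𝓝 0] fun s : ℝ => s ^ 2 := by
  set A : ℝ → ℝ := fun s =>
    coeff (1, 0) (profile k₀ r (b s) * nonlinQuot (s • profile k₀ r (b s))) with hA
  have hA2 : (fun s => A s - (r / 4 - s * r ^ 2 / 2)) =O[𝓝 0] fun s : ℝ => s ^ 2 :=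
    coeff_nonlinear_isBigO hk₀ r hb
  have hsq : (fun s : ℝ => s ^ 2) =O[𝓝 0] fun s : ℝ => s := by
    have : Tendsto (fun s : ℝ => s) (𝓝 0) (𝓝 0) := tendsto_id
    simpa [sq] using (isBigO_refl (fun s : ℝ => s) (𝓝 0)).mul (this.isBigO_one ℝ)
  have hA1 : (fun s => A s - r / 4) =O[𝓝 0] fun s : ℝ => s := by
    have h' := (hA2.trans hsq).sub
      ((isBigO_refl (fun s : ℝ => s) (𝓝 0)).const_mul_left (r ^ 2 / 2))
    refine h'.congr_left fun s => ?_
    ring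
  have hβ := coeff_isBigO (1, 0) hb
  have hmain : (fun s => (4 / r) * (-(critM g k₀ * (A s - (r / 4 - s * r ^ 2 / 2))) -
      coeff (1, 0) (b s) * (A s - r / 4))) =O[𝓝 0] fun s : ℝ => s ^ 2 := by
    refine IsBigO.const_mul_left (IsBigO.sub (hA2.const_mul_left _).neg_left ?_) _
    simpa [sq] using hβ.mul hA1
  refine hmain.congr' ?_ EventuallyEq.rfl
  filter_upwards [h] with s hs
  have h' := congrArg (coeff (1, 0)) hs
  have hq : quadForm (1, 0) = 1 := rfl
  simp only [reduced, map_add, map_sub, map_smul, smul_eq_mul, coeff_profile, coeff_lapProfile,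
    removeMean, coeff_mult, coeff_one, map_zero, hq] at h'
  norm_num at h'
  have hk : k₀ ^ 2 ≠ 0 := by positivity
  have h'' : (critM g k₀ + coeff (1, 0) (b s)) * A s = critM g k₀ * r / 4 := by
    rw [hA]
    have : (k₀ ^ 2)⁻¹ * (k₀ ^ 2 * r) = r := by field_simp
    rw [this] at h'
    rw [critM] at h' ⊢
    linear_combination h'
  field_simp
  linear_combination (-8) * h''

end Sym

theorem isSolution_zero (g : ℝ) {k₀ : ℝ} (hk₀ : 0 < k₀) (M : ℝ) : IsSolution g k₀ 0 M := by
  have h := Sym.isSolution_series (g := g) (M := M) hk₀ (a := 0) (map_zero _) (by simp) (by simp)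
  have h0 : Sym.series k₀ (Sym.invLap k₀ 0) = 0 := by
    ext x
    rw [Sym.series_apply, map_zero, map_zero, Pi.zero_apply]
  rwa [h0] at h

end

/-! ### The branch as a curve in the function space. -/

section

namespace Sym

/-- The branch of functions of amplitude `s` with the free component `b s`. -/
def branch (k₀ r : ℝ) (b : ℝ → Sym) (s : ℝ) : Plane → ℝ :=
  series k₀ (invLap k₀ (s • lapProfile k₀ r (b s)))

variable {k₀ r : ℝ} {b : ℝ → Sym}

theorem continuousAt_smul_lapProfile {s : ℝ} (hb : ContinuousAt b s) :
    ContinuousAt (fun t => t • lapProfile k₀ r (b t)) s :=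
  continuousAt_id.smul ((contDiff_lapProfile k₀ r).continuous.continuousAt.comp hb)

theorem eventually_norm_branch_lt_one (hb : ContinuousAt b 0) :
    ∀ᶠ s in 𝓝 0, ‖invLap k₀ (s • lapProfile k₀ r (b s))‖ < 1 := by
  have h : ContinuousAt (fun s => ‖invLap k₀ (s • lapProfile k₀ r (b s))‖) 0 :=
    ((invLap k₀).continuous.continuousAt.comp (continuousAt_smul_lapProfile hb)).norm
  refine h.eventually_lt continuousAt_const ?_
  simp

theorem tendsto_normH2_branch_sub (hk₀ : 0 < k₀) {s : ℝ} (hb : ContinuousAt b s) :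
    Tendsto (fun t => normH2 k₀ (branch k₀ r b t - branch k₀ r b s)) (𝓝 s) (𝓝 0) := by
  have h : Tendsto (fun t => √(7 * cellArea k₀) * (((k₀ ^ 2)⁻¹ + 1) *
      ‖t • lapProfile k₀ r (b t) - s • lapProfile k₀ r (b s)‖)) (𝓝 s) (𝓝 0) := by
    have h' := ((tendsto_iff_norm_sub_tendsto_zero.1
      (continuousAt_smul_lapProfile (k₀ := k₀) (r := r) hb)).const_mul
      ((k₀ ^ 2)⁻¹ + 1)).const_mul √(7 * cellArea k₀)
    simpa using h'
  refine squeeze_zero (fun t => Real.sqrt_nonneg _) (fun t => ?_) h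
  rw [branch, branch, ← series_sub, ← map_sub]
  exact normH2_series_invLap_le hk₀ _

/-- The difference is the series of `s • invLap (removeHex (b s))`: one factor `s` is the amplitude
and the other comes from `b = O(s)`. -/
theorem branch_sub_isBigO (hk₀ : 0 < k₀) (hb : b =O[𝓝 0] fun s : ℝ => s) :
    (fun s => normH2 k₀ (branch k₀ (normH2 k₀ (psi k₀))⁻¹ b s - s • psiHat k₀)) =O[𝓝 0]
      fun s : ℝ => s ^ 2 := by
  have h : ∀ s, branch k₀ (normH2 k₀ (psi k₀))⁻¹ b s - s • psiHat k₀ =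
      series k₀ (invLap k₀ (s • removeHex (b s))) := fun s => by
    have h' : s • psiHat k₀ = series k₀ (s • (normH2 k₀ (psi k₀))⁻¹ • chi) := by
      rw [smul_smul, series_smul_chi, psiHat, smul_smul]
    rw [h', branch, ← series_sub, map_smul, map_smul, ← smul_sub]
    change series k₀ (s • (profile k₀ (normH2 k₀ (psi k₀))⁻¹ (b s) - _)) = _
    rw [profile_eq hk₀, add_sub_cancel_left]
  simp_rw [h]
  have hO : (fun s : ℝ => s • removeHex (b s)) =O[𝓝 0] fun s : ℝ => s ^ 2 := by
    simpa [sq] using (isBigO_refl (fun s : ℝ => s) (𝓝 0)).smul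
      ((removeHex.isBigO_comp b _).trans hb)
  refine IsBigO.trans (IsBigO.of_bound (√(7 * cellArea k₀) * ((k₀ ^ 2)⁻¹ + 1))
    (Eventually.of_forall fun s => ?_)) hO
  rw [Real.norm_of_nonneg (show 0 ≤ normH2 _ _ from Real.sqrt_nonneg _), mul_assoc]
  exact normH2_series_invLap_le hk₀ _

end Sym

end

end ThinFilm

end

/-! ### The main theorem: choice of the interval and the sign of the deviation. -/

theorem theorem6 (g k₀ : ℝ) (hg : 0 < g) (hk₀ : 0 < k₀) :
    -- the trivial branch
    (∀ M : ℝ, ThinFilm.IsSolution g k₀ 0 M) ∧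
    -- the bifurcating branch, a continuous curve in `𝒰 × ℝ` through `(0, M*(k₀))`
    ∃ ε > 0, ∃ (v : ℝ → ThinFilm.Plane → ℝ) (M : ℝ → ℝ),
      (∀ s ∈ Set.Ioo (-ε) ε,
        v s ∈ ThinFilm.setU k₀ ∧ ThinFilm.IsSolution g k₀ (v s) (M s)) ∧
      (∀ s ∈ Set.Ioo (-ε) ε,
        Tendsto (fun t => ThinFilm.normH2 k₀ (v t - v s)) (𝓝 s) (𝓝 0)) ∧
      ContinuousOn M (Set.Ioo (-ε) ε) ∧
      v 0 = 0 ∧ M 0 = ThinFilm.critM g k₀ ∧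
      -- the expansions
      (fun s => ThinFilm.normH2 k₀ (v s - s • ThinFilm.psiHat k₀)) =O[𝓝 0]
        (fun s : ℝ => s ^ 2) ∧
      (fun s => M s - (ThinFilm.critM g k₀ + ThinFilm.slope g k₀ * s)) =O[𝓝 0]
        (fun s : ℝ => s ^ 2) ∧
      -- the bifurcation is transcritical
      0 < ThinFilm.slope g k₀ ∧
      (∀ s ∈ Set.Ioo (-ε) ε, s ≠ 0 → v s ≠ 0) ∧
      (∀ s ∈ Set.Ioo (-ε) 0, M s < ThinFilm.critM g k₀) ∧
      (∀ s ∈ Set.Ioo 0 ε, ThinFilm.critM g k₀ < M s) := by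
  have hN := ThinFilm.normH2_psi_pos hk₀
  -- The amplitude `r = 1/‖ψ₀‖` makes the leading profile `psiHat`.
  obtain ⟨b, hb0, hred, hcont, hbO⟩ :=
    ThinFilm.Sym.exists_branch g hk₀ (inv_ne_zero hN.ne')
  have hexp := ThinFilm.Sym.branch_sub_isBigO hk₀ hbO
  have hM := ThinFilm.Sym.coeff_parameter_isBigO hk₀ (inv_ne_zero hN.ne') hbO hred
  have hslope := ThinFilm.slope_pos hg hk₀
  have hM' : (fun s => ThinFilm.critM g k₀ + ThinFilm.Sym.coeff (1, 0) (b s) -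
      (ThinFilm.critM g k₀ + ThinFilm.slope g k₀ * s)) =O[𝓝 0] (fun s : ℝ => s ^ 2) := by
    refine hM.congr_left fun s => ?_
    rw [ThinFilm.slope_eq hk₀]
    ring
  have hsmall := ThinFilm.Sym.eventually_norm_branch_lt_one (k₀ := k₀)
    (r := (ThinFilm.normH2 k₀ (ThinFilm.psi k₀))⁻¹) hcont.self_of_nhds
  obtain ⟨C, hC, hexpC⟩ := hexp.exists_pos
  obtain ⟨C', hC', hMC⟩ := hM'.exists_pos
  have hCs : ∀ᶠ s : ℝ in 𝓝 0, C * |s| < 1 :=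
    ContinuousAt.eventually_lt (by fun_prop) (by fun_prop) (by simp)
  have hCs' : ∀ᶠ s : ℝ in 𝓝 0, C' * |s| < ThinFilm.slope g k₀ :=
    ContinuousAt.eventually_lt (by fun_prop) (by fun_prop) (by simpa using hslope)
  obtain ⟨ε, hε, hall⟩ := Metric.eventually_nhds_iff_ball.1
    (hred.and (hcont.and (hsmall.and (hexpC.bound.and (hMC.bound.and (hCs.and hCs'))))))
  rw [Real.ball_eq_Ioo, zero_sub, zero_add] at hall
  refine ⟨ThinFilm.isSolution_zero g hk₀, ε, hε,
    ThinFilm.Sym.branch k₀ (ThinFilm.normH2 k₀ (ThinFilm.psi k₀))⁻¹ b,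
    fun s => ThinFilm.critM g k₀ + ThinFilm.Sym.coeff (1, 0) (b s), fun s hs => ?_, fun s hs => ?_,
    fun s hs => ?_, ?_, ?_, hexp, hM', hslope, fun s hs hs0 hv => ?_, fun s hs => ?_,
    fun s hs => ?_⟩
  · obtain ⟨h₁, -, h₃, -⟩ := hall s hs
    exact ⟨ThinFilm.Sym.series_invLap_mem_setU hk₀ _ h₃,
      ThinFilm.Sym.isSolution_of_reduced hk₀ h₁ h₃⟩
  · exact ThinFilm.Sym.tendsto_normH2_branch_sub hk₀ (hall s hs).2.1
  · exact (continuousAt_const.add ((ThinFilm.Sym.coeff (1, 0)).continuous.continuousAt.comp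
      (hall s hs).2.1)).continuousWithinAt
  · ext x
    rw [ThinFilm.Sym.branch, ThinFilm.Sym.series_apply, zero_smul, map_zero, map_zero,
      Pi.zero_apply]
  · simp only [hb0, map_zero, add_zero]
  · obtain ⟨-, -, -, h₄, -, h₆, -⟩ := hall s hs
    rw [hv, zero_sub, ← neg_smul, ThinFilm.normH2_smul_psiHat hk₀, abs_neg, norm_pow,
      Real.norm_eq_abs, Real.norm_eq_abs, abs_abs] at h₄
    -- If `v s` were zero, the expansion would give `|s| ≤ C s²`, against `C |s| < 1`.
    nlinarith [abs_pos.2 hs0]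
  · obtain ⟨-, -, -, -, h₅, -, h₇⟩ := hall s ⟨hs.1, hs.2.trans hε⟩
    rw [norm_pow, Real.norm_eq_abs, Real.norm_eq_abs, abs_of_neg hs.2] at h₅
    rw [abs_of_neg hs.2] at h₇
    have := (abs_le.1 h₅).2
    -- The remainder is at most `C' s² < slope * |s|`, so the linear term decides the sign.
    nlinarith [hs.2]
  · obtain ⟨-, -, -, -, h₅, -, h₇⟩ := hall s ⟨(neg_neg_of_pos hε).trans hs.1, hs.2⟩
    rw [norm_pow, Real.norm_eq_abs, Real.norm_eq_abs, abs_of_pos hs.1] at h₅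
    rw [abs_of_pos hs.1] at h₇
    have := (abs_le.1 h₅).1
    nlinarith [hs.1]
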